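/- Let $\Bbbk$ be an algebraically closed field of characteristic zero, let $U$ be a unipotent algebraic group over $\Bbbk$ with Lie algebra $\mathfrak u$, and let $\lambda:\mathbb G_m\to\mathrm{Aut}(U)$ be a one-parameter subgroup whose weights $w_1>\cdots>w_n$ on $\mathfrak u$ are all positive. Put $\hat U:=U\rtimes_\lambda\mathbb G_m$, let $\mathfrak u_i:=\mathfrak u_{\lambda\geq w_i}$ be the sum of the $\lambda$-weight spaces of weight at least $w_i$, and $\mathfrak u_0:=0$. Let $\hat U$ act on an affine scheme $Y=\mathrm{Spec}(A)$ of finite type over $\Bbbk$. With $\rho^*:A\to\Bbbk[t,t^{-1}]\otimes A$ the dual action of $\mathbb G_m\subseteq\hat U$, put $A_{\lambda=w}:=\{a\in A:\rho^*(a)=t^{-w}\otimes a\}$. For a subspace $\mathfrak v\subseteq\mathfrak u$, the infinitesimal action of $\mathfrak v$ is the $A$-linear map $\Omega_{A/\Bbbk}\to\mathfrak v^*\otimes_\Bbbk A=\mathrm{Hom}_\Bbbk(\mathfrak v,A)$, $\mathrm da\mapsto(\xi\mapsto\xi.a)$, where $\xi.a=(\xi\otimes 1)(\sigma^*(a))$,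 $\sigma^*:A\to\mathcal O(U)\otimes A$ is the dual action of $U$ and $\xi\in\mathfrak u$ is regarded as a point derivation $\mathcal O(U)\to\Bbbk$ at the identity. Let $K_i$ be the kernel of the infinitesimal action of $\mathfrak u_i$, and let $\phi_i:K_{i-1}\to(\mathfrak u_i/\mathfrak u_{i-1})^*\otimes_\Bbbk A$ be the map induced by the infinitesimal action of $\mathfrak u_i$. Assume that (a) $A=\bigoplus_{w\in\mathbb Z_{\leq 0}}A_{\lambda=w}$; (b) for each $1\leq i\leq n$ there is a surjective linear map $\mathfrak u_i/\mathfrak u_{i-1}\to\mathfrak s_i$ such that the composition $(\mathfrak s_i)^*\otimes_\Bbbk A\to(\mathfrak u_i/\mathfrak u_{i-1})^*\otimes_\Bbbk A\to\mathrm{coker}(\phi_i)$ is an isomorphism. Then: (1) $A^U$ is a finitely generated $\Bbbk$-algebra, so that $Y/U:=\mathrm{Spec}(A^U)$ is affine of finite type over $\Bbbk$; (2) the morphism $Y\to Y/U$ induced by $A^U\subseteq A$ is a universal geometric quotient by $U$: for every morphism of schemes $Z'\to Y/U$, the base change $\pi:Y'=Y\times_{Y/U}Z'\to Z'$ is a geometric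 quotient for the induced action of $U$ on $Y'$, i.e. $\pi$ is affine, surjective and $U$-invariant; the morphism $U\times Y'\to Y'\times_{Z'}Y'$, $(u,y)\mapsto(y,uy)$, is surjective; $\mathcal O_{Z'}\to(\pi_*\mathcal O_{Y'})^U$ is an isomorphism; and images under $\pi$ of $U$-invariant closed subsets are closed, and of disjoint ones disjoint; (3) for some $m\geq 0$ there is an isomorphism $Y\cong\mathbb A^m\times Y/U$ over $Y/U$. -/

import Mathlib

open CategoryTheory CategoryTheory.Limits AlgebraicGeometry
open scoped TensorProduct

universe u

/-! ## Geometric quotients of schemes -/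

namespace GeomQuot

variable {P X Z : Scheme.{u}}

/-- `π : X ⟶ Z` is a geometric quotient of `X` by a group scheme `G` acting on `X`. The action
enters through the two morphisms `s t : P ⟶ X`, where `P = G × X`, `s` is the projection
`(g, x) ↦ x` and `t` is the action `(g, x) ↦ g x`. -/
structure IsGeometricQuotient (s t : P ⟶ X) (π : X ⟶ Z) : Prop where
  /-- `π` is `G`-invariant. -/
  invariant : s ≫ π = t ≫ π
  isAffineHom : IsAffineHom π
  surjective : Surjective π
  /-- The (geometric) fibres of `π` are single orbits: `(g, x) ↦ (x, g x)` maps `G × X` onto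
  `X ×_Z X`. -/
  orbits : Surjective (pullback.lift s t invariant : P ⟶ pullback π π)
  /-- `𝒪_Z → (π_* 𝒪_X)^G` is an isomorphism, first part: injectivity. -/
  injective_app : ∀ V : Z.Opens, Function.Injective (π.app V)
  /-- `𝒪_Z → (π_* 𝒪_X)^G` is an isomorphism, second part: the image consists of the invariant
  functions, i.e. those whose pull-backs along the projection and the action agree. -/
  mem_range_app : ∀ (V : Z.Opens) (f : Γ(X, π ⁻¹ᵁ V)),
    f ∈ Set.range (π.app V) ↔
      s.appLE (π ⁻¹ᵁ V) ((s ≫ π) ⁻¹ᵁ V) le_rfl f =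
        t.appLE (π ⁻¹ᵁ V) ((s ≫ π) ⁻¹ᵁ V) (by rw [invariant]; exact le_rfl) f
  /-- The image of an invariant closed subset is closed. -/
  isClosed_image : ∀ W : Set X, IsClosed W → s ⁻¹' W = t ⁻¹' W → IsClosed (π '' W)
  /-- Disjoint invariant closed subsets have disjoint images. -/
  disjoint_image : ∀ W₁ W₂ : Set X, IsClosed W₁ → IsClosed W₂ →
    s ⁻¹' W₁ = t ⁻¹' W₁ → s ⁻¹' W₂ = t ⁻¹' W₂ → Disjoint W₁ W₂ → Disjoint (π '' W₁) (π '' W₂)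

/-- The base change `G × X' ⟶ X'` of `a : P = G × X ⟶ X` (the projection or the action) along
`g : Z' ⟶ Z`, where `X' = X ×_Z Z'` and `G × X' = (G × X) ×_Z Z'`. -/
noncomputable def baseChange (p : P ⟶ Z) (π : X ⟶ Z) {Z' : Scheme.{u}} (g : Z' ⟶ Z)
    (a : P ⟶ X) (h : p = a ≫ π) : pullback p g ⟶ pullback π g :=
  pullback.map p g π g a (𝟙 Z') (𝟙 Z) (by simp [h]) (by simp)

/-- `π` is a universal geometric quotient: it is invariant, and for every morphism `Z' ⟶ Z` the
base change `X ×_Z Z' ⟶ Z'` is a geometric quotient for the induced action on `X ×_Z Z'`. -/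
def IsUniversalGeometricQuotient (s t : P ⟶ X) (π : X ⟶ Z) : Prop :=
  ∃ h : s ≫ π = t ≫ π, ∀ (Z' : Scheme.{u}) (g : Z' ⟶ Z),
    IsGeometricQuotient (baseChange (s ≫ π) π g s rfl) (baseChange (s ≫ π) π g t h)
      (pullback.snd π g)

end GeomQuot

/-! ## Affine algebraic groups through their coordinate Hopf algebras -/

namespace UHat

section Points

variable (k H R : Type u) [Field k] [CommRing H] [HopfAlgebra k H] [CommRing R] [Algebra k R]

/-- The `R`-points `U(R)` of the affine group scheme `U = Spec H` over `k`, with the group law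
given by convolution. -/
abbrev Points : Type u := WithConv (H →ₐ[k] R)

variable {k H R}

noncomputable instance : Inv (Points k H R) where
  inv f := WithConv.toConv (f.ofConv.comp (HopfAlgebra.antipodeAlgHom k H))

noncomputable instance : Group (Points k H R) where
  inv_mul_cancel f := by
    have key : (1 : Points k H R) = f⁻¹ * f := by
      apply WithConv.ofConv_injective
      ext c
      have h := congrArg f.ofConv (HopfAlgebra.mul_antipode_rTensor_comul_apply (R := k) c)
      have h2 : (f⁻¹ * f).ofConv c = f.ofConv
          (LinearMap.mul' k H ((HopfAlgebra.antipode k (A := H)).rTensor H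
            (Coalgebra.comul (R := k) c))) := by
        change (f⁻¹ * f) c = _
        rw [AlgHom.convMul_apply]
        induction Coalgebra.comul (R := k) c using TensorProduct.induction_on with
        | zero => simp
        | tmul x y => simp only [Algebra.TensorProduct.lift_tmul, LinearMap.rTensor_tmul,
            LinearMap.mul'_apply, map_mul]; rfl
        | add x y hx hy => simp only [map_add, hx, hy]
      rw [h2, h]
      simp only [AlgHom.commutes]
      exact AlgHom.convOne_apply c
    exact key.symm

/-- Functoriality `U(R) → U(S)`. -/
def Points.map {S : Type u} [CommRing S] [Algebra k S] (f : R →ₐ[k] S) (g : Points k H R) :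
    Points k H S :=
  WithConv.toConv (f.comp g.ofConv)

end Points

section Group

variable (k H : Type u) [Field k] [CommRing H] [HopfAlgebra k H]

/-- `U = Spec H` is a unipotent algebraic group: it is isomorphic to a closed subgroup of the group
of upper unitriangular `n × n`-matrices for some `n`, i.e. there is an upper unitriangular matrix
`g` over `H` which is multiplicative (`Δ(g i j) = ∑ l, g i l ⊗ g l j`) and whose entries generate
the algebra `H`. In particular `H` is then of finite type over `k`. -/
def IsUnipotent : Prop :=
  ∃ (n : ℕ) (g : Matrix (Fin n) (Fin n) H),
    (∀ i j, Coalgebra.comul (R := k) (g i j) = ∑ l, g i l ⊗ₜ[k] g l j) ∧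
    (∀ i, g i i = 1) ∧ (∀ i j, j < i → g i j = 0) ∧
    Algebra.adjoin k (Set.range fun p : Fin n × Fin n => g p.1 p.2) = ⊤

/-- The point derivations `H → k` at the identity element, as a subspace of the dual of `H`. -/
def lieSubmodule : Submodule k (H →ₗ[k] k) where
  carrier := {ξ | ∀ a b : H,
    ξ (a * b) = Coalgebra.counit (R := k) a * ξ b + ξ a * Coalgebra.counit (R := k) b}
  zero_mem' := by intro a b; simp
  add_mem' := by
    intro ξ η hξ hη a b
    simp only [LinearMap.add_apply, hξ a b, hη a b]
    ring
  smul_mem' := by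
    intro c ξ hξ a b
    simp only [LinearMap.smul_apply, hξ a b, smul_eq_mul]
    ring

/-- The vector space `𝔲 = Lie(U)`, the tangent space of `U` at the identity element. -/
def LieAlg : Type u := ↥(lieSubmodule k H)

noncomputable instance : AddCommGroup (LieAlg k H) :=
  inferInstanceAs (AddCommGroup ↥(lieSubmodule k H))

noncomputable instance : Module k (LieAlg k H) :=
  inferInstanceAs (Module k ↥(lieSubmodule k H))

/-- The inclusion of `𝔲` into the dual of `H`. -/
noncomputable def LieAlg.toDual : LieAlg k H →ₗ[k] (H →ₗ[k] k) := (lieSubmodule k H).subtype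

variable {k H} in
theorem LieAlg.toDual_mul (ξ : LieAlg k H) (a b : H) :
    LieAlg.toDual k H ξ (a * b) = Coalgebra.counit (R := k) a * LieAlg.toDual k H ξ b +
      LieAlg.toDual k H ξ a * Coalgebra.counit (R := k) b :=
  ξ.2 a b

/-- A one-parameter subgroup `λ : 𝔾ₘ → Aut(U)`: an action of the group functor `R ↦ Rˣ` on the
group functor `R ↦ U(R)` by group automorphisms, natural in the `k`-algebra `R`. -/
structure OnePS where
  act : ∀ (R : Type u) [CommRing R] [Algebra k R], Rˣ →* MulAut (Points k H R)
  natural : ∀ {R S : Type u} [CommRing R] [Algebra k R] [CommRing S] [Algebra k S]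
    (f : R →ₐ[k] S) (x : Rˣ) (g : Points k H R),
    Points.map f (act R x g) = act S (Units.map (f : R →* S) x) (Points.map f g)

/-- The coordinate `t` of `𝔾ₘ = Spec k[t, t⁻¹]`, as a unit of `k[t, t⁻¹] ⊗ B`. -/
noncomputable def unitT (B : Type u) [CommRing B] [Algebra k B] :
    (LaurentPolynomial k ⊗[k] B)ˣ where
  val := LaurentPolynomial.T 1 ⊗ₜ 1
  inv := LaurentPolynomial.T (-1) ⊗ₜ 1
  val_inv := by
    rw [Algebra.TensorProduct.tmul_mul_tmul, ← LaurentPolynomial.T_add]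
    simp [Algebra.TensorProduct.one_def]
  inv_val := by
    rw [Algebra.TensorProduct.tmul_mul_tmul, ← LaurentPolynomial.T_add]
    simp [Algebra.TensorProduct.one_def]

end Group

namespace OnePS

variable {k H : Type u} [Field k] [CommRing H] [HopfAlgebra k H] (l : OnePS k H)

/-- The dual `H → k[t, t⁻¹] ⊗ H` of the morphism `𝔾ₘ × U → U`, `(t, g) ↦ λ(t)(g)`. -/
noncomputable def coaction : H →ₐ[k] LaurentPolynomial k ⊗[k] H :=
  (l.act (LaurentPolynomial k ⊗[k] H) (unitT k H)
    (WithConv.toConv Algebra.TensorProduct.includeRight)).ofConv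

/-- The weight space `𝔲_{λ = w}`: those `ξ` with `Ad(λ(t)) ξ = t ^ w ξ`, where `Ad(λ(t)) ξ` is the
image `ξ ∘ λ(t)^*` of `ξ` under the differential at the identity element of `λ(t) : U → U`. -/
noncomputable def weightSpace (w : ℤ) : Submodule k (LieAlg k H) where
  carrier := {ξ | ∀ h : H, TensorProduct.rid k (LaurentPolynomial k)
    ((LieAlg.toDual k H ξ).lTensor (LaurentPolynomial k) (l.coaction h)) =
      (LieAlg.toDual k H ξ) h • LaurentPolynomial.T w}
  zero_mem' := by intro h; simp
  add_mem' := by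
    intro ξ η hξ hη h
    simp only [map_add, LinearMap.lTensor_add, LinearMap.add_apply, hξ h, hη h,
      add_smul]
  smul_mem' := by
    intro c ξ hξ h
    simp only [map_smul, LinearMap.lTensor_smul, LinearMap.smul_apply, hξ h,
      smul_assoc]

/-- `w` is a weight of `λ` on `𝔲`. -/
def IsWeight (w : ℤ) : Prop := l.weightSpace w ≠ ⊥

/-- `λ` is a grading one-parameter subgroup: all its weights on `𝔲` are positive. -/
def IsGrading : Prop := ∀ w, l.IsWeight w → 0 < w

/-- `𝔲_{λ ≥ w}`, the sum of the weight spaces of weight at least `w`. For the `i`-th weight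
`w = w_i` (in decreasing order) this is `𝔲_i`. -/
noncomputable def lieGE (w : ℤ) : Submodule k (LieAlg k H) :=
  ⨆ (v : ℤ) (_ : w ≤ v), l.weightSpace v

/-- `𝔲_{λ > w}`, the sum of the weight spaces of weight larger than `w`. For the `i`-th weight
`w = w_i` (in decreasing order) this is `𝔲_{i - 1}`; it is `0` for the largest weight. -/
noncomputable def lieGT (w : ℤ) : Submodule k (LieAlg k H) :=
  ⨆ (v : ℤ) (_ : w < v), l.weightSpace v

/-- The `R`-points of `Û = U ⋊_λ 𝔾ₘ`. -/
abbrev UhatPoints (R : Type u) [CommRing R] [Algebra k R] : Type u :=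
  Points k H R ⋊[l.act R] Rˣ

/-- Functoriality `Û(R) → Û(S)`. -/
def UhatPoints.map {R S : Type u} [CommRing R] [Algebra k R] [CommRing S] [Algebra k S]
    (f : R →ₐ[k] S) (g : l.UhatPoints R) : l.UhatPoints S :=
  ⟨Points.map f g.left, Units.map (f : R →* S) g.right⟩

/-- An action of `Û = U ⋊_λ 𝔾ₘ` on the affine scheme `Y = Spec A`: an action of the group `Û(R)`
on the set `Y(R)` of `k`-algebra maps `A → R`, natural in the `k`-algebra `R`. -/
structure Action (A : Type u) [CommRing A] [Algebra k A] where
  act : ∀ (R : Type u) [CommRing R] [Algebra k R], l.UhatPoints R →* Equiv.Perm (A →ₐ[k] R)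
  natural : ∀ {R S : Type u} [CommRing R] [Algebra k R] [CommRing S] [Algebra k S]
    (f : R →ₐ[k] S) (g : l.UhatPoints R) (y : A →ₐ[k] R),
    f.comp (act R g y) = act S (UhatPoints.map l f g) (f.comp y)

namespace Action

variable {l} {A : Type u} [CommRing A] [Algebra k A] (σ : l.Action A)

/-- The dual action `A → H ⊗ A` of `U`, dual to the action morphism `U × Y → Y`. -/
noncomputable def coactU : A →ₐ[k] H ⊗[k] A :=
  σ.act (H ⊗[k] A) (SemidirectProduct.inl (WithConv.toConv Algebra.TensorProduct.includeLeft))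
    Algebra.TensorProduct.includeRight

/-- The dual action `A → k[t, t⁻¹] ⊗ A` of `𝔾ₘ`, dual to the action morphism `𝔾ₘ × Y → Y`. -/
noncomputable def coactGm : A →ₐ[k] LaurentPolynomial k ⊗[k] A :=
  σ.act (LaurentPolynomial k ⊗[k] A) (SemidirectProduct.inr (unitT k A))
    Algebra.TensorProduct.includeRight

/-- The weight space `A_{λ = w}`: those `a` whose dual action is `t ^ (-w) ⊗ a`. -/
noncomputable def weightSpace (w : ℤ) : Submodule k A :=
  LinearMap.eqLocus σ.coactGm.toLinearMap
    (TensorProduct.mk k (LaurentPolynomial k) A (LaurentPolynomial.T (-w)))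

/-- The algebra `A^U` of invariants. -/
noncomputable def invariants : Subalgebra k A :=
  AlgHom.equalizer σ.coactU Algebra.TensorProduct.includeRight

/-- The `k`-linear map `a ↦ (ξ ⊗ id)(ρ(a))`, where `ρ : A → H ⊗ A` is the dual action of `U`: the
derivative of `a` in the direction of the vector field on `Y` defined by `ξ`. -/
noncomputable def vectorField : (H →ₗ[k] k) →ₗ[k] A →ₗ[k] A where
  toFun ξ := (TensorProduct.lid k A).toLinearMap ∘ₗ ξ.rTensor A ∘ₗ σ.coactU.toLinearMap
  map_add' ξ η := by ext a; simp [LinearMap.rTensor_add]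
  map_smul' c ξ := by ext a; simp [LinearMap.rTensor_smul]

/-- The identity element acts trivially: `(ε ⊗ id)(ρ(a)) = a`. -/
theorem counit_coactU (a : A) :
    Algebra.TensorProduct.lift (Algebra.ofId k A |>.comp (Bialgebra.counitAlgHom k H))
      (AlgHom.id k A) (fun _ _ => .all ..) (σ.coactU a) = a := by
  set f := Algebra.TensorProduct.lift (Algebra.ofId k A |>.comp (Bialgebra.counitAlgHom k H))
      (AlgHom.id k A) (fun _ _ => .all ..) with hf
  have h := σ.natural f
    (SemidirectProduct.inl (WithConv.toConv Algebra.TensorProduct.includeLeft))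
    Algebra.TensorProduct.includeRight
  have h1 : UhatPoints.map l f (SemidirectProduct.inl
      (WithConv.toConv Algebra.TensorProduct.includeLeft)) = 1 := by
    apply SemidirectProduct.ext
    · apply WithConv.ofConv_injective
      ext x
      simp [UhatPoints.map, Points.map, hf, AlgHom.convOne_def]
    · simp [UhatPoints.map]
  rw [h1, map_one] at h
  have h2 := DFunLike.congr_fun h a
  change f (σ.coactU a) = f (1 ⊗ₜ a) at h2
  rw [h2]
  simp [hf]

theorem vectorField_mul (ξ : LieAlg k H) (a b : A) :
    σ.vectorField (LieAlg.toDual k H ξ) (a * b) = a * σ.vectorField (LieAlg.toDual k H ξ) b + b * σ.vectorField (LieAlg.toDual k H ξ) a := by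
  have key : ∀ x y : H ⊗[k] A,
      TensorProduct.lid k A ((LieAlg.toDual k H ξ).rTensor A (x * y)) =
        Algebra.TensorProduct.lift (Algebra.ofId k A |>.comp (Bialgebra.counitAlgHom k H))
          (AlgHom.id k A) (fun _ _ => .all ..) x *
            TensorProduct.lid k A ((LieAlg.toDual k H ξ).rTensor A y) +
        Algebra.TensorProduct.lift (Algebra.ofId k A |>.comp (Bialgebra.counitAlgHom k H))
          (AlgHom.id k A) (fun _ _ => .all ..) y *
            TensorProduct.lid k A ((LieAlg.toDual k H ξ).rTensor A x) := by
    intro x y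
    induction x using TensorProduct.induction_on with
    | zero => simp
    | add x₁ x₂ h₁ h₂ => simp only [add_mul, map_add, h₁, h₂, mul_add]; ring
    | tmul p c =>
      induction y using TensorProduct.induction_on with
      | zero => simp
      | add y₁ y₂ h₁ h₂ => simp only [mul_add, map_add, h₁, h₂, add_mul]; ring
      | tmul q d =>
        have hξ := LieAlg.toDual_mul ξ p q
        simp only [Algebra.TensorProduct.tmul_mul_tmul, LinearMap.rTensor_tmul,
          TensorProduct.lid_tmul, hξ, Algebra.TensorProduct.lift_tmul, AlgHom.comp_apply,
          Algebra.ofId_apply, AlgHom.id_apply, Bialgebra.counitAlgHom_apply, Algebra.smul_def,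
          map_add, map_mul]
        ring
  have h := key (σ.coactU a) (σ.coactU b)
  rw [counit_coactU, counit_coactU, ← map_mul] at h
  exact h

/-- The derivation `A → 𝔲^* ⊗ A = Hom_k(𝔲, A)`, `a ↦ (ξ ↦ ξ.a)`. -/
noncomputable def infDerivation : Derivation k A (LieAlg k H →ₗ[k] A) where
  toFun a := (σ.vectorField.flip a) ∘ₗ LieAlg.toDual k H
  map_add' a b := by ext ξ; simp
  map_smul' c a := by ext ξ; simp
  map_one_eq_zero' := by
    ext ξ
    have h := σ.vectorField_mul ξ 1 1
    simp only [mul_one, one_mul] at h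
    have h' : σ.vectorField (LieAlg.toDual k H ξ) 1 = 0 := by simpa using h
    simpa using h'
  leibniz' a b := by
    ext ξ
    simpa using σ.vectorField_mul ξ a b

/-- The infinitesimal action `φ : Ω_{A/k} → 𝔳^* ⊗ A` of a subspace `𝔳 ⊆ 𝔲` on `Y`. Since `𝔲` is
finite dimensional, `𝔳^* ⊗ A` is written as the `A`-module `Hom_k(𝔳, A)`. -/
noncomputable def infAction (𝔳 : Submodule k (LieAlg k H)) : Ω[A⁄k] →ₗ[A] (𝔳 →ₗ[k] A) :=
  LinearMap.lcomp A A 𝔳.subtype ∘ₗ σ.infDerivation.liftKaehlerDifferential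

/-- The map `φ_{(𝔳 : 𝔴)} : K(𝔴) → (𝔳 / 𝔴)^* ⊗ A` for subspaces `𝔴 ⊆ 𝔳` of `𝔲`, where `K(𝔴)` is the
kernel of the infinitesimal action of `𝔴`: it is induced by the infinitesimal action of `𝔳`. -/
noncomputable def relInfAction (𝔳 𝔴 : Submodule k (LieAlg k H)) :
    LinearMap.ker (σ.infAction 𝔴) →ₗ[A] ((𝔳 ⧸ 𝔴.submoduleOf 𝔳) →ₗ[k] A) where
  toFun κ := (𝔴.submoduleOf 𝔳).liftQ (σ.infAction 𝔳 κ) (by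
    intro ξ hξ
    exact LinearMap.congr_fun (LinearMap.mem_ker.1 κ.2) ⟨(ξ : LieAlg k H), hξ⟩)
  map_add' κ κ' := by
    apply LinearMap.ext
    intro x
    obtain ⟨ξ, rfl⟩ := Submodule.Quotient.mk_surjective _ x
    simp
    rfl
  map_smul' a κ := by
    apply LinearMap.ext
    intro x
    obtain ⟨ξ, rfl⟩ := Submodule.Quotient.mk_surjective _ x
    simp
    rfl

/-- There is a surjective linear map `q : 𝔳 / 𝔴 → 𝔰` such that the composition
`𝔰^* ⊗ A → (𝔳 / 𝔴)^* ⊗ A → coker φ_{(𝔳 : 𝔴)}` is an isomorphism. -/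
def HasConstantCokernel (𝔳 𝔴 : Submodule k (LieAlg k H)) : Prop :=
  ∃ (𝔰 : Type u) (_ : AddCommGroup 𝔰) (_ : Module k 𝔰)
    (q : (𝔳 ⧸ 𝔴.submoduleOf 𝔳) →ₗ[k] 𝔰), Function.Surjective q ∧
      Function.Bijective ((LinearMap.range (σ.relInfAction 𝔳 𝔴)).mkQ ∘ₗ
        (LinearMap.lcomp A A q : (𝔰 →ₗ[k] A) →ₗ[A] _))

/-- The affine CDRS ("constant dimension of relative stabilisers") condition for the action of `Û`
on `Y = Spec A`: `A` is the direct sum of its weight spaces of non-positive weight, and for each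
weight `w = w_i` of `λ` on `𝔲`, with `𝔲_i = 𝔲_{λ ≥ w}` and `𝔲_{i-1} = 𝔲_{λ > w}`, the cokernel of
`φ_i : K_{i-1} → (𝔲_i / 𝔲_{i-1})^* ⊗ A` is `(𝔰_i)^* ⊗ A` for a quotient `𝔰_i` of
`𝔲_i / 𝔲_{i-1}`. -/
def IsAffineCDRS : Prop :=
  DirectSum.IsInternal (fun w : {w : ℤ // w ≤ 0} => σ.weightSpace w) ∧
    ∀ w : ℤ, l.IsWeight w → σ.HasConstantCokernel (l.lieGE w) (l.lieGT w)

/-- `U × Y = Spec (H ⊗ A)`. -/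
noncomputable def groupTimes (_σ : l.Action A) : Scheme.{u} := Spec (.of (H ⊗[k] A))

/-- The projection `U × Y ⟶ Y`. -/
noncomputable def projMor : σ.groupTimes ⟶ Spec (.of A) :=
  Spec.map (CommRingCat.ofHom
    (Algebra.TensorProduct.includeRight : A →ₐ[k] H ⊗[k] A).toRingHom)

/-- The action `U × Y ⟶ Y`. -/
noncomputable def actMor : σ.groupTimes ⟶ Spec (.of A) :=
  Spec.map (CommRingCat.ofHom σ.coactU.toRingHom)

/-- `Y / U = Spec A^U`. -/
noncomputable def quotientScheme : Scheme.{u} := Spec (.of σ.invariants)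

/-- The morphism `Y ⟶ Y / U` given by the inclusion `A^U ⊆ A`. -/
noncomputable def quotientMor : Spec (.of A) ⟶ σ.quotientScheme :=
  Spec.map (CommRingCat.ofHom (algebraMap σ.invariants A))

end Action

end OnePS

end UHat

/-!
The proof is elementary. It shows that `A` is a polynomial algebra over `A^U`, and that two points
of `Y` with values in any `k`-algebra which agree on `A^U` are conjugate under `U`; the three
assertions follow formally from these two facts.

An element `ξ` of `𝔲` of weight `w > 0` acts on `A` as a derivation which raises weights by `w`.
As the weights of `A` are bounded above, this derivation is locally nilpotent. The hypothesis on
the cokernel of `φ_i` says that on the kernel of `𝔲_i / 𝔲_{i-1} → 𝔰_i` the elements of `K_{i-1}`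
take arbitrary constant values, and that those which vanish on this kernel vanish on `𝔲_i`. Taking
components of weight zero one finds `ξ_1, …, ξ_r` of weight `w_i`, lifting a basis of the kernel,
and functions `x_1, …, x_r`, annihilated by `𝔲_{i-1}`, with `ξ_p.x_q = δ_{pq}`, such that a
function annihilated by `𝔲_{i-1}` and by `ξ_1, …, ξ_r` is annihilated by all of `𝔲_i`
(`UHat.OnePS.Action.isSliceTower_lieGE`). Here `K_{i-1}` is spanned by differentials of functions
annihilated by `𝔲_{i-1}`, by induction along the tower of slices
(`SliceTower.IsSliceTower.mem_span_of_forall_eq_zero`).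

A locally nilpotent derivation `D` of `B` with a slice `x`, `D x = 1`, makes `B` a polynomial
algebra in `x` over `ker D`. Hence `A` is a polynomial algebra over the algebra of functions
annihilated by `𝔲` (`SliceTower.IsSliceTower.exists_bijective_aeval`), and in characteristic zero
this algebra is `A^U` (`UHat.OnePS.Action.mem_invariants_iff`). The one-parameter groups `exp(c
ξ_p)` change the values of the slices arbitrarily, one after the other, and thereby conjugate any
two points which agree on `A^U` (`UHat.OnePS.Action.IsAffineCDRS.exists_act_eq`). The exponential
`exp(c ξ)` is a point of `U` because the coordinate ring of a unipotent group is conilpotent, so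
that convolution with `ξ` is locally nilpotent (`UHat.expPoint`).

Finally, setting the polynomial generators to zero gives a section of `Y → Y/U`, and applying the
conjugacy to the two projections of `Y ×_{Y/U} Y` gives a section of `U × Y → Y ×_{Y/U} Y`. These
two sections persist under base change and force all the properties of a geometric quotient
(`GeomQuot.isGeometricQuotient_of_section`).
-/

/-! ### Locally nilpotent derivations and slices -/

namespace SliceTower

section Exponential

variable {k A R : Type*} [Field k] [CommRing A] [Algebra k A] [CommRing R]
  [Algebra k R]

theorem iterate_derivation_mul (D : Derivation k A A) (n : ℕ) (a b : A) :
    D^[n] (a * b) = ∑ ij ∈ Finset.HasAntidiagonal.antidiagonal n,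
      n.choose ij.1 • (D^[ij.1] a * D^[ij.2] b) := by
  induction n with
  | zero => simp
  | succ n ih =>
    rw [Finset.sum_antidiagonal_choose_succ_nsmul (M := A) (fun i j => D^[i] a * D^[j] b) n]
    simp only [Function.iterate_succ_apply', ih, map_sum, map_nsmul, Derivation.leibniz, smul_add,
      Finset.sum_add_distrib, add_right_inj, smul_eq_mul]
    refine Finset.sum_congr rfl fun ⟨i, j⟩ hij ↦ ?_
    rw [n.choose_symm_of_eq_add (Finset.HasAntidiagonal.mem_antidiagonal.1 hij).symm, mul_comm]

/-- The divided power `Dⁿ / n!` of a derivation. -/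
noncomputable def dividedPower (D : Derivation k A A) (n : ℕ) : A →ₗ[k] A :=
  (n.factorial : k)⁻¹ • (D : A →ₗ[k] A) ^ n

theorem dividedPower_apply (D : Derivation k A A) (n : ℕ) (a : A) :
    dividedPower D n a = (n.factorial : k)⁻¹ • D^[n] a := by
  simp [dividedPower, Module.End.pow_apply]

theorem dividedPower_mul [CharZero k] (D : Derivation k A A) (n : ℕ) (a b : A) :
    dividedPower D n (a * b) =
      ∑ ij ∈ Finset.HasAntidiagonal.antidiagonal n,
        dividedPower D ij.1 a * dividedPower D ij.2 b := by
  simp only [dividedPower_apply, iterate_derivation_mul, Finset.smul_sum]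
  refine Finset.sum_congr rfl fun ⟨i, j⟩ hij ↦ ?_
  obtain rfl := Finset.HasAntidiagonal.mem_antidiagonal.1 hij
  have h : ((i + j).factorial : k)⁻¹ * ((i + j).choose i : k) =
      (i.factorial : k)⁻¹ * (j.factorial : k)⁻¹ := by
    have h1 : ((i + j).choose i : k) * i.factorial * j.factorial = (i + j).factorial := by
      rw [Nat.choose_symm_add]
      exact_mod_cast Nat.add_choose_mul_factorial_mul_factorial i j
    have h2 : ((i + j).factorial : k) ≠ 0 := by exact_mod_cast Nat.factorial_ne_zero _
    have h3 : (i.factorial : k) ≠ 0 := by exact_mod_cast Nat.factorial_ne_zero _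
    have h4 : (j.factorial : k) ≠ 0 := by exact_mod_cast Nat.factorial_ne_zero _
    field_simp
    linear_combination h1
  rw [← Nat.cast_smul_eq_nsmul k, smul_smul, h, smul_mul_smul_comm]

/-- A derivation is locally nilpotent if each element is killed by some power of it. -/
def IsLocallyNilpotent (D : Derivation k A A) : Prop := ∀ a, ∃ n, D^[n] a = 0

theorem iterate_eq_zero_of_le (D : Derivation k A A) {a : A} {n m : ℕ} (h : D^[n] a = 0)
    (hnm : n ≤ m) : D^[m] a = 0 := by
  obtain ⟨j, rfl⟩ := Nat.exists_eq_add_of_le' hnm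
  rw [Function.iterate_add_apply, h]
  exact Function.iterate_fixed (map_zero D) j

/-- The polynomial `∑ φ(Dⁿ a / n!) Xⁿ`. -/
noncomputable def expPolyFun (D : Derivation k A A) (hD : IsLocallyNilpotent D) (φ : A →ₐ[k] R)
    (a : A) : Polynomial R :=
  ∑ n ∈ Finset.range (hD a).choose, Polynomial.monomial n (φ (dividedPower D n a))

theorem coeff_expPolyFun (D : Derivation k A A) (hD : IsLocallyNilpotent D) (φ : A →ₐ[k] R)
    (a : A) (n : ℕ) : (expPolyFun D hD φ a).coeff n = φ (dividedPower D n a) := by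
  simp only [expPolyFun, Polynomial.finsetSum_coeff, Polynomial.coeff_monomial,
    Finset.sum_ite_eq', Finset.mem_range, ite_eq_left_iff, not_lt]
  intro h
  rw [dividedPower_apply, iterate_eq_zero_of_le D (hD a).choose_spec h, smul_zero, map_zero]

/-- The exponential `a ↦ ∑ φ(Dⁿ a / n!) Xⁿ` of a locally nilpotent derivation `D`, followed by the
algebra map `φ`. It is an algebra map by Leibniz' rule. -/
noncomputable def expPoly [CharZero k] (D : Derivation k A A) (hD : IsLocallyNilpotent D)
    (φ : A →ₐ[k] R) : A →ₐ[k] Polynomial R where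
  toFun := expPolyFun D hD φ
  map_zero' := by ext n; simp [coeff_expPolyFun]
  map_add' a b := by ext n; simp [coeff_expPolyFun]
  map_one' := by
    ext n
    rw [coeff_expPolyFun, dividedPower_apply]
    rcases n with _ | n
    · simp
    · simp [Function.iterate_succ_apply, Function.iterate_fixed (map_zero D) n,
        Polynomial.coeff_one]
  map_mul' a b := by
    ext n
    simp [coeff_expPolyFun, Polynomial.coeff_mul, dividedPower_mul]
  commutes' r := by
    ext n
    rw [coeff_expPolyFun, dividedPower_apply, Polynomial.algebraMap_apply, Polynomial.coeff_C]
    rcases n with _ | n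
    · simp
    · simp [Function.iterate_succ_apply, Function.iterate_fixed (map_zero D) n]

theorem coeff_expPoly [CharZero k] (D : Derivation k A A) (hD : IsLocallyNilpotent D)
    (φ : A →ₐ[k] R) (a : A) (n : ℕ) : (expPoly D hD φ a).coeff n = φ (dividedPower D n a) :=
  coeff_expPolyFun D hD φ a n

end Exponential

section Tower

variable {k A : Type*} [Field k] [CommRing A] [Algebra k A]

/-- The algebra of constants `{a | D a = 0}` of a derivation. -/
def constants (D : Derivation k A A) : Subalgebra k A where
  carrier := {a | D a = 0}
  mul_mem' := by
    intro a b ha hb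
    rw [Set.mem_ofPred_eq] at ha hb ⊢
    rw [Derivation.leibniz, ha, hb]
    simp
  add_mem' := by
    intro a b ha hb
    rw [Set.mem_ofPred_eq] at ha hb ⊢
    rw [map_add, ha, hb, add_zero]
  algebraMap_mem' r := D.map_algebraMap r

theorem mem_constants {D : Derivation k A A} {a : A} : a ∈ constants D ↔ D a = 0 := Iff.rfl

/-- A subalgebra `B` is the end of a slice tower for a set `E` of derivations if it is obtained
from the whole algebra by repeatedly passing from a subalgebra `B` to the constants in `B` of some
locally nilpotent `D ∈ E` which preserves `B` and has a slice `x ∈ B`, that is, `D x = 1`. -/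
inductive IsSliceTower (E : Set (Derivation k A A)) : Subalgebra k A → Prop
  | top : IsSliceTower E ⊤
  | step {B : Subalgebra k A} (D : Derivation k A A) (x : A) : IsSliceTower E B → D ∈ E →
      (∀ b ∈ B, D b ∈ B) → IsLocallyNilpotent D → x ∈ B → D x = 1 →
      IsSliceTower E (B ⊓ constants D)

theorem IsSliceTower.mono {E E' : Set (Derivation k A A)} (hE : E ⊆ E') {B : Subalgebra k A}
    (h : IsSliceTower E B) : IsSliceTower E' B := by
  induction h with
  | top => exact .top
  | step D x _ hD h₁ h₂ hx hDx ih => exact .step D x ih (hE hD) h₁ h₂ hx hDx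

section Slice

variable {B : Subalgebra k A} {D : Derivation k A A} {x : A}

theorem derivation_aeval (hDx : D x = 1)
    (p : Polynomial ↥(B ⊓ constants D)) :
    D (Polynomial.aeval x p) = Polynomial.aeval x p.derivative := by
  induction p using Polynomial.induction_on' with
  | add p q hp hq => simp [hp, hq]
  | monomial n c =>
    have hc : D (c : A) = 0 := c.2.2
    have hc' : algebraMap ↥(B ⊓ constants D) A c = (c : A) := rfl
    simp only [Polynomial.aeval_monomial, Polynomial.derivative_monomial, Derivation.leibniz,
      Derivation.leibniz_pow, hDx, hc', hc, map_mul, map_natCast]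
    simp
    ring

theorem aeval_mem (hx : x ∈ B) (p : Polynomial ↥(B ⊓ constants D)) :
    Polynomial.aeval x p ∈ B := by
  induction p using Polynomial.induction_on' with
  | add p q hp hq => rw [map_add]; exact add_mem hp hq
  | monomial n c =>
    rw [Polynomial.aeval_monomial]
    exact mul_mem c.2.1 (pow_mem hx n)

variable [CharZero k]

theorem aeval_slice_injective (hDx : D x = 1) (p : Polynomial ↥(B ⊓ constants D))
    (hp : Polynomial.aeval x p = 0) : p = 0 := by
  induction hn : p.natDegree using Nat.strong_induction_on generalizing p with
  | _ n ih =>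
  by_cases h0 : p.natDegree = 0
  · obtain ⟨c, rfl⟩ := Polynomial.natDegree_eq_zero.1 h0
    rw [Polynomial.aeval_C] at hp
    have hc : c = 0 := Subtype.ext hp
    rw [hc, Polynomial.C_0]
  · have h1 := ih _ (hn ▸ Polynomial.natDegree_derivative_lt h0) p.derivative
      (by rw [← derivation_aeval hDx, hp, map_zero]) rfl
    have h2 : IsAddTorsionFree ↥(B ⊓ constants D) := .of_isTorsionFree k _
    exact absurd (Polynomial.derivative_eq_zero.1 h1) h0

theorem derivative_surjective : Function.Surjective
    (Polynomial.derivative : Polynomial ↥(B ⊓ constants D) →ₗ[_] _) := by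
  intro q
  induction q using Polynomial.induction_on' with
  | add p q hp hq =>
    obtain ⟨p', rfl⟩ := hp
    obtain ⟨q', rfl⟩ := hq
    exact ⟨p' + q', map_add _ _ _⟩
  | monomial n c =>
    refine ⟨Polynomial.monomial (n + 1) (((n : k) + 1)⁻¹ • c), ?_⟩
    have h : ((n : k) + 1) ≠ 0 := by exact_mod_cast n.succ_ne_zero
    rw [Polynomial.derivative_monomial, Nat.add_sub_cancel, smul_mul_assoc]
    congr 1
    rw [inv_smul_eq_iff₀ h, Algebra.smul_def, mul_comm]
    simp

/-- Integrating the Taylor expansion of `D b` with respect to the slice `x`, every element killed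
by a power of `D` is a polynomial in `x` with coefficients that are constants. -/
theorem exists_aeval_slice (hB : ∀ b ∈ B, D b ∈ B) (hx : x ∈ B) (hDx : D x = 1) (n : ℕ) :
    ∀ b ∈ B, D^[n] b = 0 → ∃ p : Polynomial ↥(B ⊓ constants D), Polynomial.aeval x p = b := by
  induction n with
  | zero => exact fun b _ h => ⟨0, by simpa using h.symm⟩
  | succ n ih =>
    intro b hb h
    obtain ⟨q, hq⟩ := ih (D b) (hB b hb) h
    obtain ⟨p, rfl⟩ := derivative_surjective q
    have hc : b - Polynomial.aeval x p ∈ B ⊓ constants D := by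
      refine ⟨sub_mem hb (aeval_mem hx p), ?_⟩
      change D (b - Polynomial.aeval x p) = 0
      rw [map_sub, derivation_aeval hDx, hq, sub_self]
    refine ⟨p + Polynomial.C ⟨_, hc⟩, ?_⟩
    rw [map_add, Polynomial.aeval_C]
    exact add_sub_cancel _ _

end Slice

/-- The end of a slice tower is a subalgebra over which the algebra is a polynomial algebra. -/
theorem IsSliceTower.exists_bijective_aeval [CharZero k] {E : Set (Derivation k A A)}
    {B : Subalgebra k A} (h : IsSliceTower E B) :
    ∃ (ι : Type) (_ : Finite ι) (x : ι → A),
      Function.Bijective (MvPolynomial.aeval x : MvPolynomial ι B →ₐ[B] A) := by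
  induction h with
  | top =>
    refine ⟨Empty, inferInstance, Empty.elim, ?_, fun a => ⟨MvPolynomial.C ⟨a, trivial⟩, ?_⟩⟩
    · intro p q hpq
      obtain ⟨a, rfl⟩ := MvPolynomial.C_surjective Empty p
      obtain ⟨b, rfl⟩ := MvPolynomial.C_surjective Empty q
      rw [MvPolynomial.aeval_C, MvPolynomial.aeval_C] at hpq
      have hab : a = b := Subtype.ext hpq
      rw [hab]
    · rw [MvPolynomial.aeval_C]
      rfl
  | @step B D x _ _ hB hnil hx hDx ih =>
    obtain ⟨ι, hι, y, hy⟩ := ih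
    let θ : Polynomial ↥(B ⊓ constants D) →+* B :=
      Polynomial.eval₂RingHom (Subalgebra.inclusion inf_le_left).toRingHom ⟨x, hx⟩
    have hθ (p) : (θ p : A) = Polynomial.aeval x p := by
      have : B.val.toRingHom.comp θ = (Polynomial.aeval x).toRingHom := by
        ext <;> simp [θ]
      exact DFunLike.congr_fun this p
    have hθb : Function.Bijective θ := by
      constructor
      · rw [injective_iff_map_eq_zero]
        intro p hp
        exact aeval_slice_injective hDx p (by rw [← hθ, hp]; rfl)
      · rintro ⟨b, hb⟩
        obtain ⟨n, hn⟩ := hnil b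
        obtain ⟨p, hp⟩ := exists_aeval_slice hB hx hDx n b hb hn
        exact ⟨p, Subtype.ext ((hθ p).trans hp)⟩
    refine ⟨Option ι, inferInstance, fun i => i.elim x y, ?_⟩
    have key : ⇑(MvPolynomial.aeval (fun i : Option ι => i.elim x y) :
        MvPolynomial (Option ι) ↥(B ⊓ constants D) →ₐ[_] A) =
        (MvPolynomial.aeval y : MvPolynomial ι B →ₐ[B] A) ∘ MvPolynomial.map θ ∘
          MvPolynomial.optionEquivRight ↥(B ⊓ constants D) ι := by
      have : (MvPolynomial.aeval (fun i : Option ι => i.elim x y) :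
          MvPolynomial (Option ι) ↥(B ⊓ constants D) →ₐ[_] A).toRingHom =
          (MvPolynomial.aeval y : MvPolynomial ι B →ₐ[B] A).toRingHom.comp
            ((MvPolynomial.map θ).comp
              (MvPolynomial.optionEquivRight ↥(B ⊓ constants D) ι).toRingEquiv.toRingHom) := by
        apply MvPolynomial.ringHom_ext
        · intro r
          simp [θ]
        · rintro (_ | i)
          · simp [θ]
          · simp
      exact congrArg DFunLike.coe this
    rw [key]
    exact hy.comp (Function.Bijective.comp
      ⟨MvPolynomial.map_injective _ hθb.1, MvPolynomial.map_surjective _ hθb.2⟩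
      (MvPolynomial.optionEquivRight _ ι).bijective)

/-- A differential which is killed by all derivations in a slice tower is a combination of
differentials of elements of the end of the tower. -/
theorem IsSliceTower.mem_span_of_forall_eq_zero [CharZero k] {E : Set (Derivation k A A)}
    {B : Subalgebra k A} (h : IsSliceTower E B) (ω : Ω[A⁄k])
    (hω : ∀ D ∈ E, D.liftKaehlerDifferential ω = 0) :
    ω ∈ Submodule.span A (KaehlerDifferential.D k A '' B) := by
  induction h with
  | top =>
    have h := KaehlerDifferential.span_range_derivation k A
    rw [← Set.image_univ] at h
    exact h ▸ Submodule.mem_top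
  | @step B D x _ hDE hB hnil hx hDx ih =>
    set M := Submodule.span A (KaehlerDifferential.D k A '' (B ⊓ constants D : Subalgebra k A))
    have hM : M ≤ LinearMap.ker D.liftKaehlerDifferential := by
      rw [Submodule.span_le]
      rintro _ ⟨b, hb, rfl⟩
      rw [SetLike.mem_coe, LinearMap.mem_ker, Derivation.liftKaehlerDifferential_comp_D]
      exact hb.2
    have hle : Submodule.span A (KaehlerDifferential.D k A '' B) ≤
        M ⊔ Submodule.span A {KaehlerDifferential.D k A x} := by
      rw [Submodule.span_le]
      rintro _ ⟨b, hb, rfl⟩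
      obtain ⟨n, hn⟩ := hnil b
      obtain ⟨p, rfl⟩ := exists_aeval_slice hB hx hDx n b hb hn
      clear hn hb
      induction p using Polynomial.induction_on' with
      | add p q hp hq =>
        rw [map_add, map_add]
        exact add_mem hp hq
      | monomial n c =>
        rw [Polynomial.aeval_monomial, Derivation.leibniz, Derivation.leibniz_pow]
        refine add_mem (Submodule.smul_mem _ _ (Submodule.smul_of_tower_mem _ _ ?_))
          (Submodule.smul_mem _ _ ?_)
        · exact Submodule.smul_mem _ _
            (Submodule.mem_sup_right (Submodule.mem_span_singleton_self _))
        · exact Submodule.mem_sup_left (Submodule.subset_span ⟨_, c.2, rfl⟩)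
    obtain ⟨ω', hω', η, hη, rfl⟩ := Submodule.mem_sup.1 (hle ih)
    obtain ⟨a, rfl⟩ := Submodule.mem_span_singleton.1 hη
    have h0 := hω D hDE
    rw [map_add, hM hω', zero_add, map_smul, Derivation.liftKaehlerDifferential_comp_D, hDx,
      smul_eq_mul, mul_one] at h0
    rw [h0, zero_smul, add_zero]
    exact hω'

/-- Suppose that an equivalence relation on points `y : A → R` allows to move, for `D` in the
tower, the values of slices of `D` arbitrarily without changing the values at constants of `D`.
Then points which agree on the end of the tower are equivalent. -/
theorem IsSliceTower.rel_of_forall_eq [CharZero k] {E : Set (Derivation k A A)}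
    {B : Subalgebra k A} (h : IsSliceTower E B) {R : Type*} [CommRing R] [Algebra k R]
    (r : Setoid (A →ₐ[k] R))
    (hr : ∀ D ∈ E, ∀ (c : R) (y : A →ₐ[k] R), ∃ y', r y y' ∧ (∀ b, D b = 0 → y' b = y b) ∧
      ∀ x, D x = 1 → y' x = y x + c) (y y' : A →ₐ[k] R) (hy : ∀ b ∈ B, y b = y' b) : r y y' := by
  induction h generalizing y with
  | top =>
    obtain rfl : y = y' := AlgHom.ext fun a => hy a trivial
    exact r.refl y
  | @step B D x _ hDE hB hnil hx hDx ih =>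
    obtain ⟨z, hz, hz1, hz2⟩ := hr D hDE (y' x - y x) y
    refine r.trans hz (ih z fun b hb => ?_)
    obtain ⟨n, hn⟩ := hnil b
    obtain ⟨p, rfl⟩ := exists_aeval_slice hB hx hDx n b hb hn
    clear hn hb
    induction p using Polynomial.induction_on' with
    | add p q hp hq => rw [map_add, map_add, map_add, hp, hq]
    | monomial n c =>
      rw [Polynomial.aeval_monomial, map_mul, map_mul, map_pow, map_pow, hz2 x hDx,
        add_sub_cancel]
      congr 1
      exact (hz1 _ c.2.2).trans (hy _ c.2)

end Tower

end SliceTower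

/-! ### Functionals on a Hopf algebra -/

namespace UHat

section Functionals

variable {k : Type u} [Field k]

/-- The partial evaluation `id ⊗ χ : M ⊗ H → M` of a functional. -/
noncomputable def evalRight {H : Type u} [AddCommGroup H] [Module k H] (M : Type u)
    [AddCommGroup M] [Module k M] (χ : H →ₗ[k] k) : M ⊗[k] H →ₗ[k] M :=
  (TensorProduct.rid k M).toLinearMap ∘ₗ χ.lTensor M

/-- The partial evaluation `χ ⊗ id : H ⊗ M → M` of a functional. -/
noncomputable def evalLeft {H : Type u} [AddCommGroup H] [Module k H] (M : Type u)
    [AddCommGroup M] [Module k M] (χ : H →ₗ[k] k) : H ⊗[k] M →ₗ[k] M :=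
  (TensorProduct.lid k M).toLinearMap ∘ₗ χ.rTensor M

section Modules

variable {H M : Type u} [AddCommGroup H] [Module k H] [AddCommGroup M] [Module k M]

@[simp]
theorem evalRight_tmul (χ : H →ₗ[k] k) (m : M) (h : H) : evalRight M χ (m ⊗ₜ h) = χ h • m := by
  simp [evalRight]

@[simp]
theorem evalLeft_tmul (χ : H →ₗ[k] k) (m : M) (h : H) : evalLeft M χ (h ⊗ₜ m) = χ h • m := by
  simp [evalLeft]

theorem evalRight_separates {z : M ⊗[k] H} (hz : ∀ χ : H →ₗ[k] k, evalRight M χ z = 0) :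
    z = 0 := by
  classical
  let b := Module.Basis.ofVectorSpace k H
  apply (TensorProduct.equivFinsuppOfBasisRight b).injective
  rw [map_zero]
  ext i
  have : (Finsupp.lapply i ∘ₗ (TensorProduct.equivFinsuppOfBasisRight (M := M) b).toLinearMap) =
      evalRight M (b.coord i) := by
    ext m h
    simp
  exact (LinearMap.congr_fun this z).trans (hz _)

theorem eval_comm (χ : H →ₗ[k] k) (f : M →ₗ[k] k) (z : H ⊗[k] M) :
    χ (evalRight H f z) = f (evalLeft M χ z) := by
  induction z using TensorProduct.induction_on with
  | zero => simp
  | add x y hx hy => simp only [map_add, hx, hy]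
  | tmul h m => simp [mul_comm]

end Modules

variable {H : Type u} [CommRing H] [HopfAlgebra k H]

/-- A point derivation `ξ` at the identity extends to an `A`-linear derivation along the identity
section `A ⊗ H → A`. -/
theorem evalRight_mul {A : Type u} [CommRing A] [Algebra k A] (ξ : LieAlg k H)
    (x y : A ⊗[k] H) :
    evalRight A (LieAlg.toDual k H ξ) (x * y) =
      evalRight A Coalgebra.counit x * evalRight A (LieAlg.toDual k H ξ) y +
        evalRight A (LieAlg.toDual k H ξ) x * evalRight A Coalgebra.counit y := by
  induction x using TensorProduct.induction_on with
  | zero => simp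
  | add x₁ x₂ h₁ h₂ => simp only [add_mul, map_add, h₁, h₂]; ring
  | tmul p c =>
    induction y using TensorProduct.induction_on with
    | zero => simp
    | add y₁ y₂ h₁ h₂ => simp only [mul_add, map_add, h₁, h₂]; ring
    | tmul q d =>
      simp only [Algebra.TensorProduct.tmul_mul_tmul, evalRight_tmul, LieAlg.toDual_mul,
        add_smul, mul_smul, smul_mul_smul_comm]

theorem toDual_one (ξ : LieAlg k H) : LieAlg.toDual k H ξ 1 = 0 := by
  have h := LieAlg.toDual_mul ξ 1 1
  simpa using h

theorem toDual_algebraMap (ξ : LieAlg k H) (c : k) :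
    LieAlg.toDual k H ξ (algebraMap k H c) = 0 := by
  rw [Algebra.algebraMap_eq_smul_one, map_smul, toDual_one, smul_zero]

/-- The operator `h ↦ (id ⊗ χ)(Δ h)` on functions: the right convolution by `χ`. -/
noncomputable def rightConv (χ : H →ₗ[k] k) : H →ₗ[k] H :=
  evalRight H χ ∘ₗ Coalgebra.comul

/-- The convolution product of functionals, `(χ * ψ)(h) = (χ ⊗ ψ)(Δ h)`. -/
noncomputable def conv (χ ψ : H →ₗ[k] k) : H →ₗ[k] k := χ ∘ₗ rightConv ψ

theorem conv_apply (χ ψ : H →ₗ[k] k) (h : H) :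
    conv χ ψ h = LinearMap.mul' k k (TensorProduct.map χ ψ (Coalgebra.comul h)) := by
  simp only [conv, rightConv, LinearMap.comp_apply]
  induction (Coalgebra.comul h : H ⊗[k] H) using TensorProduct.induction_on with
  | zero => simp
  | add x y hx hy => simp only [map_add, hx, hy]
  | tmul a b => simp [mul_comm]

theorem conv_eq_evalLeft (χ ψ : H →ₗ[k] k) (h : H) :
    conv χ ψ h = ψ (evalLeft H χ (Coalgebra.comul h)) :=
  eval_comm χ ψ _

theorem rightConv_counit (h : H) : rightConv (Coalgebra.counit (R := k)) h = h := by
  simp [rightConv, evalRight]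

theorem counit_rightConv (χ : H →ₗ[k] k) (h : H) :
    Coalgebra.counit (R := k) (rightConv χ h) = χ h := by
  have h1 : evalLeft H (Coalgebra.counit (R := k)) (Coalgebra.comul h) = h := by
    simp [evalLeft]
  rw [rightConv, LinearMap.comp_apply, eval_comm, h1]

/-- Left and right convolutions commute. -/
theorem evalLeft_comul_rightConv (ξ χ : H →ₗ[k] k) (h : H) :
    evalLeft H ξ (Coalgebra.comul (rightConv χ h)) =
      rightConv χ (evalLeft H ξ (Coalgebra.comul h)) := by
  have e := Coalgebra.coassoc_apply (R := k) h
  have h1 (z : H ⊗[k] H) : evalLeft H ξ (Coalgebra.comul (evalRight H χ z)) =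
      evalLeft H ξ ((evalRight H χ).lTensor H
        (TensorProduct.assoc k H H H ((Coalgebra.comul (R := k)).rTensor H z))) := by
    induction z using TensorProduct.induction_on with
    | zero => simp
    | add x y hx hy => simp only [map_add, hx, hy]
    | tmul a b =>
      simp only [evalRight_tmul, map_smul, LinearMap.rTensor_tmul]
      induction (Coalgebra.comul a : H ⊗[k] H) using TensorProduct.induction_on with
      | zero => simp
      | add x y hx hy => simp only [map_add, smul_add, hx, hy, TensorProduct.add_tmul]
      | tmul c d => simp [smul_smul, mul_comm]
  have h2 (z : H ⊗[k] H) : evalLeft H ξ ((evalRight H χ).lTensor H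
      ((Coalgebra.comul (R := k)).lTensor H z)) = rightConv χ (evalLeft H ξ z) := by
    induction z using TensorProduct.induction_on with
    | zero => simp
    | add x y hx hy => simp only [map_add, hx, hy]
    | tmul a b => simp [rightConv]
  rw [rightConv, LinearMap.comp_apply, h1, e, h2]
  rfl

/-- The invariant derivation `h ↦ (id ⊗ ξ)(Δ h)` of `H` defined by a point derivation `ξ`. -/
noncomputable def invariantDerivation (ξ : LieAlg k H) : Derivation k H H :=
  Derivation.mk' (rightConv (LieAlg.toDual k H ξ)) fun a b => by
    have h := evalRight_mul ξ (Coalgebra.comul (R := k) a) (Coalgebra.comul (R := k) b)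
    have e (c : H) : evalRight H (Coalgebra.counit (R := k)) (Coalgebra.comul c) = c :=
      rightConv_counit c
    rw [e, e] at h
    simp only [rightConv, LinearMap.comp_apply, Bialgebra.comul_mul, h, smul_eq_mul]
    ring

theorem invariantDerivation_apply (ξ : LieAlg k H) (h : H) :
    invariantDerivation ξ h = rightConv (LieAlg.toDual k H ξ) h := rfl

/-- The commutator of two point derivations for the convolution product is a point derivation: this
is the Lie bracket of `𝔲`. -/
noncomputable def bracket (ξ η : LieAlg k H) : LieAlg k H :=
  ⟨conv (LieAlg.toDual k H ξ) (LieAlg.toDual k H η) -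
      conv (LieAlg.toDual k H η) (LieAlg.toDual k H ξ), by
    intro a b
    have h (ξ η : LieAlg k H) (a b : H) :
        conv (LieAlg.toDual k H ξ) (LieAlg.toDual k H η) (a * b) =
        Coalgebra.counit (R := k) a * conv (LieAlg.toDual k H ξ) (LieAlg.toDual k H η) b +
        LieAlg.toDual k H η a * LieAlg.toDual k H ξ b +
        LieAlg.toDual k H η b * LieAlg.toDual k H ξ a +
        Coalgebra.counit (R := k) b * conv (LieAlg.toDual k H ξ) (LieAlg.toDual k H η) a := by
      have h1 := (invariantDerivation η).leibniz a b
      simp only [invariantDerivation_apply, smul_eq_mul] at h1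
      simp only [conv, LinearMap.comp_apply, h1, map_add, LieAlg.toDual_mul, counit_rightConv]
      ring
    simp only [LinearMap.sub_apply, h]
    ring⟩

theorem toDual_bracket (ξ η : LieAlg k H) : LieAlg.toDual k H (bracket ξ η) =
    conv (LieAlg.toDual k H ξ) (LieAlg.toDual k H η) -
      conv (LieAlg.toDual k H η) (LieAlg.toDual k H ξ) := rfl

end Functionals

end UHat

/-! ### Unipotent groups in characteristic zero -/

namespace UHat

section Unipotent

variable {k H : Type u} [Field k] [CommRing H] [HopfAlgebra k H]

variable (k H) in
/-- The linear map `h ↦ Δ h - h ⊗ 1`. -/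
noncomputable def reducedComul : H →ₗ[k] H ⊗[k] H :=
  Coalgebra.comul - (TensorProduct.mk k H H).flip 1

theorem comul_eq_add_reducedComul (h : H) :
    Coalgebra.comul (R := k) h = h ⊗ₜ 1 + reducedComul k H h := by
  simp [reducedComul]

variable (k H) in
/-- The conilpotency filtration of `H`: it starts with `0`, and `h` lies in step `n + 1` if
`Δ h - h ⊗ 1` lies in the tensor product of step `n` with `H`. -/
noncomputable def conil : ℕ → Submodule k H
  | 0 => ⊥
  | n + 1 => (Submodule.map₂ (TensorProduct.mk k H H) (conil n) ⊤).comap (reducedComul k H)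

theorem mem_conil_succ {n : ℕ} {h : H} : h ∈ conil k H (n + 1) ↔
    reducedComul k H h ∈ Submodule.map₂ (TensorProduct.mk k H H) (conil k H n) ⊤ := Iff.rfl

theorem conil_le_succ (n : ℕ) : conil k H n ≤ conil k H (n + 1) := by
  induction n with
  | zero => exact bot_le
  | succ n ih => exact Submodule.comap_mono (Submodule.map₂_le_map₂_left ih)

theorem conil_mono : Monotone (conil k H) := monotone_nat_of_le_succ conil_le_succ

theorem one_mem_conil : (1 : H) ∈ conil k H 1 := by
  rw [mem_conil_succ]
  have : reducedComul k H 1 = 0 := by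
    simp [reducedComul, Bialgebra.comul_one, Algebra.TensorProduct.one_def]
  rw [this]
  exact zero_mem _

theorem map₂_mul_le {F G K : Submodule k H} (h : ∀ a ∈ F, ∀ b ∈ G, a * b ∈ K) {x y : H ⊗[k] H}
    (hx : x ∈ Submodule.map₂ (TensorProduct.mk k H H) F ⊤)
    (hy : y ∈ Submodule.map₂ (TensorProduct.mk k H H) G ⊤) :
    x * y ∈ Submodule.map₂ (TensorProduct.mk k H H) K ⊤ := by
  have h1 : Submodule.map₂ (TensorProduct.mk k H H) F ⊤ ≤
      (Submodule.map₂ (TensorProduct.mk k H H) K ⊤).comap (LinearMap.mulRight k y) := by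
    rw [Submodule.map₂_le]
    intro a ha c _
    have h2 : Submodule.map₂ (TensorProduct.mk k H H) G ⊤ ≤
        (Submodule.map₂ (TensorProduct.mk k H H) K ⊤).comap (LinearMap.mulLeft k (a ⊗ₜ c)) := by
      rw [Submodule.map₂_le]
      intro b hb d _
      rw [Submodule.mem_comap, LinearMap.mulLeft_apply, TensorProduct.mk_apply,
        Algebra.TensorProduct.tmul_mul_tmul]
      exact Submodule.apply_mem_map₂ _ (h a ha b hb) trivial
    exact h2 hy
  exact h1 hx

theorem mul_mem_conil (n : ℕ) : ∀ a b : ℕ, a + b = n → ∀ x ∈ conil k H a, ∀ y ∈ conil k H b,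
    x * y ∈ conil k H (a + b) := by
  induction n using Nat.strong_induction_on with
  | _ n ih =>
  rintro (_ | a) (_ | b) hab x hx y hy
  · rw [(Submodule.mem_bot k).1 hx, zero_mul]
    exact zero_mem _
  · rw [(Submodule.mem_bot k).1 hx, zero_mul]
    exact zero_mem _
  · rw [(Submodule.mem_bot k).1 hy, mul_zero]
    exact zero_mem _
  have hx' := mem_conil_succ.1 hx
  have hy' := mem_conil_succ.1 hy
  have e : a + 1 + (b + 1) = a + b + 1 + 1 := by omega
  rw [e, mem_conil_succ]
  have key : reducedComul k H (x * y) = (x ⊗ₜ 1) * reducedComul k H y +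
      reducedComul k H x * (y ⊗ₜ 1) + reducedComul k H x * reducedComul k H y := by
    have h1 : reducedComul k H (x * y) = Coalgebra.comul (R := k) (x * y) - (x * y) ⊗ₜ 1 := rfl
    have h2 : (x * y) ⊗ₜ[k] (1 : H) = (x ⊗ₜ 1) * (y ⊗ₜ 1) := by simp
    rw [h1, Bialgebra.comul_mul, comul_eq_add_reducedComul x, comul_eq_add_reducedComul y, h2]
    ring
  rw [key]
  refine add_mem (add_mem ?_ ?_) ?_
  · refine map₂_mul_le (F := conil k H (a + 1)) (G := conil k H b) (fun c hc d hd => ?_)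
      (Submodule.apply_mem_map₂ (TensorProduct.mk k H H) hx trivial) hy'
    exact conil_mono (by omega) (ih (a + 1 + b) (by omega) (a + 1) b rfl c hc d hd)
  · refine map₂_mul_le (F := conil k H a) (G := conil k H (b + 1)) (fun c hc d hd => ?_)
      hx' (Submodule.apply_mem_map₂ (TensorProduct.mk k H H) hy trivial)
    exact conil_mono (by omega) (ih (a + (b + 1)) (by omega) a (b + 1) rfl c hc d hd)
  · refine map₂_mul_le (F := conil k H a) (G := conil k H b) (fun c hc d hd => ?_) hx' hy'
    exact conil_mono (by omega) (ih (a + b) (by omega) a b rfl c hc d hd)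

/-- The functions on a unipotent group are exhausted by the conilpotency filtration: a matrix
coefficient `g i j` of the defining representation lies in step `j - i + 1`. -/
theorem IsUnipotent.exists_mem_conil (hU : IsUnipotent k H) (h : H) : ∃ n, h ∈ conil k H n := by
  obtain ⟨N, g, hg, hdiag, hlow, hgen⟩ := hU
  have hmat : ∀ (n : ℕ) (i j : Fin N), (j : ℕ) < i + n → g i j ∈ conil k H n := by
    intro n
    induction n with
    | zero =>
      intro i j hij
      rw [hlow i j (by simpa using hij)]
      exact zero_mem _
    | succ n ih =>
      intro i j hij
      rw [mem_conil_succ]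
      have e : reducedComul k H (g i j) = ∑ l ∈ Finset.univ.erase j, g i l ⊗ₜ[k] g l j := by
        rw [← add_right_inj (g i j ⊗ₜ[k] (1 : H)), ← comul_eq_add_reducedComul, hg, ← hdiag j,
          Finset.add_sum_erase _ (fun l => g i l ⊗ₜ[k] g l j) (Finset.mem_univ j)]
      rw [e]
      refine Submodule.sum_mem _ fun l hl => ?_
      rcases lt_or_gt_of_ne (Finset.ne_of_mem_erase hl) with hlj | hlj
      · have : (l : ℕ) < j := hlj
        exact Submodule.apply_mem_map₂ _ (ih i l (by omega)) trivial
      · rw [hlow l j hlj, TensorProduct.tmul_zero]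
        exact zero_mem _
  have hh : h ∈ Algebra.adjoin k (Set.range fun p : Fin N × Fin N => g p.1 p.2) := by
    rw [hgen]
    trivial
  induction hh using Algebra.adjoin_induction with
  | mem x hx =>
    obtain ⟨p, rfl⟩ := hx
    exact ⟨_, hmat N p.1 p.2 (by omega)⟩
  | algebraMap r =>
    refine ⟨1, ?_⟩
    rw [Algebra.algebraMap_eq_smul_one]
    exact Submodule.smul_mem _ _ one_mem_conil
  | add x y _ _ hx hy =>
    obtain ⟨n, hx⟩ := hx
    obtain ⟨m, hy⟩ := hy
    exact ⟨max n m, add_mem (conil_mono (le_max_left _ _) hx) (conil_mono (le_max_right _ _) hy)⟩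
  | mul x y _ _ hx hy =>
    obtain ⟨n, hx⟩ := hx
    obtain ⟨m, hy⟩ := hy
    exact ⟨n + m, mul_mem_conil _ n m rfl x hx y hy⟩

theorem evalRight_mem_of_mem_map₂ {F : Submodule k H} (χ : H →ₗ[k] k) {x : H ⊗[k] H}
    (hx : x ∈ Submodule.map₂ (TensorProduct.mk k H H) F ⊤) : evalRight H χ x ∈ F := by
  have h : Submodule.map₂ (TensorProduct.mk k H H) F ⊤ ≤ F.comap (evalRight H χ) := by
    rw [Submodule.map₂_le]
    intro a ha b _
    rw [Submodule.mem_comap, TensorProduct.mk_apply, evalRight_tmul]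
    exact F.smul_mem _ ha
  exact h hx

theorem rightConv_eq (χ : H →ₗ[k] k) (h : H) :
    rightConv χ h = χ 1 • h + evalRight H χ (reducedComul k H h) := by
  rw [rightConv, LinearMap.comp_apply, comul_eq_add_reducedComul, map_add, evalRight_tmul]

/-- Invariant derivations lower the conilpotency filtration. -/
theorem IsUnipotent.isLocallyNilpotent [CharZero k] (hU : IsUnipotent k H) (ξ : LieAlg k H) :
    SliceTower.IsLocallyNilpotent (invariantDerivation ξ) := by
  have key : ∀ n, ∀ h ∈ conil k H n, (invariantDerivation ξ)^[n] h = 0 := by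
    intro n
    induction n with
    | zero => exact fun h hh => (Submodule.mem_bot k).1 hh
    | succ n ih =>
      intro h hh
      rw [Function.iterate_succ_apply]
      refine ih _ ?_
      rw [invariantDerivation_apply, rightConv_eq, toDual_one, zero_smul, zero_add]
      exact evalRight_mem_of_mem_map₂ _ (mem_conil_succ.1 hh)
  intro h
  obtain ⟨n, hn⟩ := hU.exists_mem_conil h
  exact ⟨n, key n h hn⟩

/-- The one-parameter subgroup `exp(X ξ)` of `U`, as a point over the polynomial ring `R[X]`. -/
noncomputable def expPoint [CharZero k] (hU : IsUnipotent k H) (ξ : LieAlg k H) (R : Type u)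
    [CommRing R] [Algebra k R] : H →ₐ[k] Polynomial R :=
  SliceTower.expPoly (invariantDerivation ξ) (hU.isLocallyNilpotent ξ)
    ((Algebra.ofId k R).comp (Bialgebra.counitAlgHom k H))

section Primitive

theorem powPoint_succ (N : ℕ) (h : H) :
    (WithConv.toConv (AlgHom.id k H) ^ (N + 1)).ofConv h =
      LinearMap.mul' k H ((WithConv.toConv (AlgHom.id k H) ^ N).ofConv.toLinearMap.rTensor H
        (Coalgebra.comul (R := k) h)) := by
  rw [pow_succ]
  change (WithConv.toConv (AlgHom.id k H) ^ N * WithConv.toConv (AlgHom.id k H)) h = _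
  rw [AlgHom.convMul_apply]
  induction (Coalgebra.comul (R := k) h) using TensorProduct.induction_on with
  | zero => simp
  | add x y hx hy => simp only [map_add, hx, hy]
  | tmul a b => simp

variable (k H) in
/-- The sequences `N ↦ ∑ (N choose m) c m` in `H`, the sum being over `m < n`. -/
def newtonSequences (n : ℕ) : Submodule k (ℕ → H) where
  carrier := {s | ∃ c : ℕ → H, ∀ N, s N = ∑ m ∈ Finset.range n, N.choose m • c m}
  zero_mem' := ⟨0, by simp⟩
  add_mem' := by
    rintro s t ⟨c, hc⟩ ⟨d, hd⟩
    exact ⟨c + d, fun N => by simp [hc, hd, Finset.sum_add_distrib]⟩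
  smul_mem' := by
    rintro r s ⟨c, hc⟩
    refine ⟨r • c, fun N => ?_⟩
    simp only [Pi.smul_apply, hc, Finset.smul_sum, smul_comm r]

theorem mem_newtonSequences_succ {n : ℕ} {s : ℕ → H}
    (hs : (fun N => s (N + 1) - s N) ∈ newtonSequences k H n) :
    s ∈ newtonSequences k H (n + 1) := by
  obtain ⟨c, hc⟩ := hs
  refine ⟨fun m => m.casesOn (s 0) c, fun N => ?_⟩
  induction N with
  | zero =>
    rw [Finset.sum_range_succ']
    simp
  | succ N ih =>
    have h := hc N
    rw [sub_eq_iff_eq_add, ih] at h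
    rw [h, Finset.sum_range_succ', Finset.sum_range_succ', ← add_assoc, ← Finset.sum_add_distrib]
    simp [Nat.choose_succ_succ, add_smul]

/-- The values at `h` of the power maps `u ↦ u ^ N` of a unipotent group are polynomial in `N`. -/
theorem IsUnipotent.exists_polynomial [CharZero k] (hU : IsUnipotent k H) (h : H) :
    ∃ P : Polynomial H, ∀ N : ℕ,
      (WithConv.toConv (AlgHom.id k H) ^ N).ofConv h = P.eval (N : H) := by
  have key : ∀ n, ∀ h ∈ conil k H n, (fun N : ℕ =>
      (WithConv.toConv (AlgHom.id k H) ^ N).ofConv h) ∈ newtonSequences k H n := by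
    intro n
    induction n with
    | zero =>
      intro h hh
      rw [(Submodule.mem_bot k).1 hh]
      refine ⟨0, fun N => ?_⟩
      simp
    | succ n ih =>
      intro h hh
      refine mem_newtonSequences_succ ?_
      -- the difference of consecutive terms is `N ↦ m ∘ (u ^ N ⊗ id)` at `Δ h - h ⊗ 1`
      have e : (fun N : ℕ => (WithConv.toConv (AlgHom.id k H) ^ (N + 1)).ofConv h -
          (WithConv.toConv (AlgHom.id k H) ^ N).ofConv h) = fun N => LinearMap.mul' k H
            ((WithConv.toConv (AlgHom.id k H) ^ N).ofConv.toLinearMap.rTensor H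
              (reducedComul k H h)) := by
        funext N
        rw [powPoint_succ, comul_eq_add_reducedComul, map_add, map_add]
        simp
      rw [e]
      have hle : Submodule.map₂ (TensorProduct.mk k H H) (conil k H n) ⊤ ≤
          (newtonSequences k H n).comap (LinearMap.pi fun N : ℕ => LinearMap.mul' k H ∘ₗ
            (WithConv.toConv (AlgHom.id k H) ^ N).ofConv.toLinearMap.rTensor H) := by
        rw [Submodule.map₂_le]
        intro a ha b _
        obtain ⟨c, hc⟩ := ih a ha
        refine ⟨fun m => c m * b, fun N => ?_⟩
        simp only [LinearMap.pi_apply, LinearMap.comp_apply, TensorProduct.mk_apply,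
          LinearMap.rTensor_tmul, LinearMap.mul'_apply, AlgHom.toLinearMap_apply, hc,
          Finset.sum_mul, smul_mul_assoc]
      exact hle (mem_conil_succ.1 hh)
  obtain ⟨n, hn⟩ := hU.exists_mem_conil h
  obtain ⟨c, hc⟩ := key n h hn
  refine ⟨∑ m ∈ Finset.range n, Polynomial.C ((m.factorial : k)⁻¹ • c m) * descPochhammer H m,
    fun N => ?_⟩
  refine (hc N).trans ?_
  rw [Polynomial.eval_finsetSum]
  refine Finset.sum_congr rfl fun m _ => ?_
  rw [Polynomial.eval_mul, Polynomial.eval_C, descPochhammer_eval_eq_descFactorial,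
    Nat.descFactorial_eq_factorial_mul_choose, smul_mul_assoc, eq_inv_smul_iff₀
    (by exact_mod_cast m.factorial_ne_zero), Nat.cast_smul_eq_nsmul, nsmul_eq_mul, nsmul_eq_mul]
  push_cast
  ring

/-- A polynomial over a `k`-algebra whose values at natural numbers `N` are `N h` has linear
coefficient `h`. -/
theorem coeff_one_of_eval_eq_nsmul [CharZero k] {P : Polynomial H} {h : H}
    (hP : ∀ N : ℕ, P.eval (N : H) = N • h) : P.coeff 1 = h := by
  refine sub_eq_zero.1 ((Module.forall_dual_apply_eq_zero_iff k _).1 fun f => ?_)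
  let Q : Polynomial k := ∑ i ∈ P.support, Polynomial.monomial i (f (P.coeff i))
  have hQ (n : ℕ) : Q.coeff n = f (P.coeff n) := by
    simp only [Q, Polynomial.finsetSum_coeff, Polynomial.coeff_monomial, Finset.sum_ite_eq']
    split_ifs with hn
    · rfl
    · rw [Polynomial.notMem_support_iff.1 hn, map_zero]
  have hQe (N : ℕ) : Q.eval (N : k) = f (P.eval (N : H)) := by
    rw [Polynomial.eval_eq_sum (p := P), Polynomial.sum, map_sum, Polynomial.eval_finsetSum]
    refine Finset.sum_congr rfl fun i _ => ?_
    have : P.coeff i * (N : H) ^ i = ((N : k) ^ i) • P.coeff i := by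
      rw [Algebra.smul_def, map_pow, map_natCast, mul_comm]
    rw [this, map_smul, Polynomial.eval_monomial, smul_eq_mul, mul_comm]
  have hX : Q = Polynomial.X * Polynomial.C (f h) := by
    refine Polynomial.eq_of_infinite_eval_eq _ _ (Set.Infinite.mono ?_
      (Set.infinite_range_of_injective (Nat.cast_injective (R := k))))
    rintro _ ⟨N, rfl⟩
    change Q.eval _ = (Polynomial.X * Polynomial.C (f h)).eval _
    rw [hQe, hP, map_nsmul, Polynomial.eval_mul, Polynomial.eval_X, Polynomial.eval_C,
      nsmul_eq_mul]
  rw [map_sub, ← hQ, hX]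
  simp

/-- In characteristic zero, a primitive element of the square of the augmentation ideal of a
unipotent group vanishes: its value `N h` at the `N`-th power map is a polynomial in `N` without
linear term. -/
theorem IsUnipotent.eq_zero_of_primitive [CharZero k] (hU : IsUnipotent k H) {h : H}
    (hh : Coalgebra.comul (R := k) h = h ⊗ₜ 1 + 1 ⊗ₜ h)
    (hI : h ∈ RingHom.ker (Bialgebra.counitAlgHom k H) * RingHom.ker (Bialgebra.counitAlgHom k H)) :
    h = 0 := by
  have h1 : ∃ P : Polynomial H, (∀ N : ℕ,
      (WithConv.toConv (AlgHom.id k H) ^ N).ofConv h = P.eval (N : H)) ∧ P.coeff 1 = 0 := by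
    clear hh
    induction hI using Submodule.mul_induction_on' with
    | mem_mul_mem a ha b hb =>
      have h0 {a : H} (ha : a ∈ RingHom.ker (Bialgebra.counitAlgHom k H)) {P : Polynomial H}
          (hP : ∀ N : ℕ, (WithConv.toConv (AlgHom.id k H) ^ N).ofConv a = P.eval (N : H)) :
          P.coeff 0 = 0 := by
        have := hP 0
        rw [Nat.cast_zero, ← Polynomial.coeff_zero_eq_eval_zero, pow_zero] at this
        rw [← this]
        change (1 : Points k H H) a = 0
        rw [AlgHom.convOne_apply]
        have ha' : Coalgebra.counit (R := k) a = 0 := ha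
        rw [ha', map_zero]
      obtain ⟨P, hP⟩ := hU.exists_polynomial a
      obtain ⟨Q, hQ⟩ := hU.exists_polynomial b
      refine ⟨P * Q, fun N => by rw [map_mul, hP, hQ, Polynomial.eval_mul], ?_⟩
      rw [Polynomial.mul_coeff_one, h0 ha hP, h0 hb hQ, zero_mul, mul_zero, add_zero]
    | add a _ b _ iha ihb =>
      obtain ⟨P, hP, hP1⟩ := iha
      obtain ⟨Q, hQ, hQ1⟩ := ihb
      exact ⟨P + Q, fun N => by rw [map_add, hP, hQ, Polynomial.eval_add], by simp [hP1, hQ1]⟩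
  obtain ⟨P, hP, hP1⟩ := h1
  rw [← hP1]
  refine (coeff_one_of_eval_eq_nsmul (k := k) fun N => ?_).symm
  rw [← hP]
  induction N with
  | zero =>
    rw [pow_zero, zero_smul]
    change (1 : Points k H H) h = 0
    rw [AlgHom.convOne_apply]
    have : Coalgebra.counit (R := k) h = 0 := by
      have := Ideal.mul_le_left hI
      exact this
    rw [this, map_zero]
  | succ N ih =>
    rw [powPoint_succ, hh, map_add, map_add, succ_nsmul]
    simp [ih]

end Primitive

/-- A function in the augmentation ideal that is killed by all point derivations lies in the square
of the augmentation ideal. -/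
theorem mem_ker_mul_ker {h : H} (h0 : Coalgebra.counit (R := k) h = 0)
    (hξ : ∀ ξ : LieAlg k H, LieAlg.toDual k H ξ h = 0) :
    h ∈ RingHom.ker (Bialgebra.counitAlgHom k H) * RingHom.ker (Bialgebra.counitAlgHom k H) := by
  set I := RingHom.ker (Bialgebra.counitAlgHom k H)
  by_contra hI
  obtain ⟨f, hf, hfI⟩ := Submodule.exists_le_ker_of_notMem (p := (I * I).restrictScalars k) hI
  let ξ : LieAlg k H := ⟨f - f 1 • Coalgebra.counit, by
    intro a b
    have hab : (a - algebraMap k H (Coalgebra.counit a)) *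
        (b - algebraMap k H (Coalgebra.counit b)) ∈ I * I := by
      have hI (c : H) : c - algebraMap k H (Coalgebra.counit c) ∈ I := by
        rw [RingHom.mem_ker, map_sub, AlgHom.commutes]
        exact sub_self _
      exact Ideal.mul_mem_mul (hI a) (hI b)
    have hz : f _ = 0 := hfI hab
    have e : (a - algebraMap k H (Coalgebra.counit a)) *
        (b - algebraMap k H (Coalgebra.counit b)) = a * b - (Coalgebra.counit (R := k) a) • b -
          (Coalgebra.counit (R := k) b) • a +
            (Coalgebra.counit (R := k) a * Coalgebra.counit (R := k) b) • 1 := by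
      simp only [Algebra.smul_def, map_mul]
      ring
    rw [e] at hz
    simp only [map_add, map_sub, map_smul, smul_eq_mul] at hz
    simp only [LinearMap.sub_apply, LinearMap.smul_apply, smul_eq_mul, Bialgebra.counit_mul]
    linear_combination hz⟩
  have h2 : f h - f 1 * Coalgebra.counit (R := k) h = 0 := hξ ξ
  rw [h0, mul_zero, sub_zero] at h2
  exact hf h2

/-- A unipotent group in characteristic zero is connected: a function annihilated by all invariant
vector fields is constant. -/
theorem IsUnipotent.eq_algebraMap [CharZero k] (hU : IsUnipotent k H) {h : H}
    (hh : ∀ ξ : LieAlg k H, evalLeft H (LieAlg.toDual k H ξ) (Coalgebra.comul h) = 0) :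
    h = algebraMap k H (Coalgebra.counit h) := by
  obtain ⟨n, hn⟩ := hU.exists_mem_conil h
  induction n generalizing h with
  | zero =>
    rw [(Submodule.mem_bot k).1 hn]
    simp
  | succ n ih =>
    set c := Coalgebra.counit (R := k) h with hc
    set g := h - algebraMap k H c with hg
    have h1 (χ : H →ₗ[k] k) : evalRight H χ (reducedComul k H h) = rightConv χ h - χ 1 • h := by
      rw [rightConv_eq, add_sub_cancel_left]
    have h2 (χ : H →ₗ[k] k) : evalRight H χ (reducedComul k H h) =
        algebraMap k H (χ g) := by
      have := ih (h := evalRight H χ (reducedComul k H h)) (fun ξ => by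
        rw [h1, map_sub, map_sub, map_smul, map_smul, evalLeft_comul_rightConv, hh ξ]
        simp) (evalRight_mem_of_mem_map₂ _ (mem_conil_succ.1 hn))
      rw [this, h1]
      congr 1
      rw [map_sub, counit_rightConv, map_smul, hg, map_sub,
        Algebra.algebraMap_eq_smul_one c, map_smul, smul_eq_mul, smul_eq_mul, mul_comm]
    have h3 : reducedComul k H h = 1 ⊗ₜ g := by
      refine sub_eq_zero.1 (evalRight_separates fun χ => ?_)
      rw [map_sub, h2, evalRight_tmul, Algebra.algebraMap_eq_smul_one, sub_self]
    have h4 : Coalgebra.comul (R := k) g = g ⊗ₜ 1 + 1 ⊗ₜ g := by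
      rw [hg, map_sub, Bialgebra.comul_algebraMap, comul_eq_add_reducedComul, h3,
        TensorProduct.sub_tmul, Algebra.TensorProduct.algebraMap_apply]
      abel
    have h5 (ξ : LieAlg k H) : LieAlg.toDual k H ξ g = 0 := by
      have := hh ξ
      rw [comul_eq_add_reducedComul, h3, map_add, evalLeft_tmul, evalLeft_tmul, toDual_one,
        zero_smul, add_zero] at this
      have h6 := congrArg (Coalgebra.counit (R := k)) this
      rw [map_smul, Bialgebra.counit_one, map_zero, smul_eq_mul, mul_one] at h6
      rw [hg, map_sub, h6, toDual_algebraMap, sub_self]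
    have h0 : Coalgebra.counit (R := k) g = 0 := by
      rw [hg, map_sub, Bialgebra.counit_algebraMap, sub_self]
    exact sub_eq_zero.1 (hU.eq_zero_of_primitive h4 (mem_ker_mul_ker h0 h5))

end Unipotent

end UHat

/-! ### Weights of a one-parameter subgroup on the Lie algebra -/

namespace UHat

section Laurent

variable {k : Type u} [Field k]

theorem laurent_induction {M : LaurentPolynomial k → Prop} (p : LaurentPolynomial k)
    (add : ∀ p q, M p → M q → M (p + q))
    (smul_T : ∀ (n : ℤ) (a : k), M (a • LaurentPolynomial.T n)) : M p :=
  LaurentPolynomial.induction_on' p add fun n a => by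
    rw [← LaurentPolynomial.smul_eq_C_mul]
    exact smul_T n a

/-- The evaluation `k[t, t⁻¹] → R` at a unit `x`. -/
noncomputable def evalT {R : Type u} [CommRing R] [Algebra k R] (x : Rˣ) :
    LaurentPolynomial k →ₐ[k] R where
  toRingHom := LaurentPolynomial.eval₂ (algebraMap k R) x
  commutes' r := LaurentPolynomial.eval₂_C (algebraMap k R) x r

theorem evalT_T {R : Type u} [CommRing R] [Algebra k R] (x : Rˣ) (n : ℤ) :
    evalT (k := k) x (LaurentPolynomial.T n) = ((x ^ n : Rˣ) : R) :=
  LaurentPolynomial.eval₂_T _ _ n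

theorem laurent_algHom_ext {R : Type u} [CommRing R] [Algebra k R]
    {f g : LaurentPolynomial k →ₐ[k] R}
    (h : f (LaurentPolynomial.T 1) = g (LaurentPolynomial.T 1)) : f = g := by
  exact AddMonoidAlgebra.algHom_ext' (R := k) (MonoidHom.ext_mint h) (Subsingleton.elim _ _)

theorem val_mul_zpow {R : Type u} [CommRing R] [Algebra k R] {x y : Rˣ}
    (f g : LaurentPolynomial k →ₐ[k] R) (hf : f (LaurentPolynomial.T 1) = x)
    (hg : g (LaurentPolynomial.T 1) = y) (m : ℤ) :
    (((x * y) ^ m : Rˣ) : R) = f (LaurentPolynomial.T m) * g (LaurentPolynomial.T m) := by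
  have h {z : Rˣ} (f : LaurentPolynomial k →ₐ[k] R) (hf : f (LaurentPolynomial.T 1) = z) :
      evalT z = f := laurent_algHom_ext (by rw [evalT_T, zpow_one, hf])
  rw [mul_zpow, Units.val_mul, ← evalT_T (k := k), ← evalT_T (k := k), h f hf, h g hg]

variable (k) in
/-- The coefficient of `t ^ n`. -/
def laurentCoeff (n : ℤ) : LaurentPolynomial k →ₗ[k] k where
  toFun p := p.coeff n
  map_add' _ _ := rfl
  map_smul' _ _ := rfl

theorem laurentCoeff_T (n m : ℤ) :
    laurentCoeff k n (LaurentPolynomial.T m) = if m = n then 1 else 0 :=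
  LaurentPolynomial.T_apply n m

theorem eq_sum_laurentCoeff (p : LaurentPolynomial k) (S : Finset ℤ)
    (hS : ∀ n ∉ S, laurentCoeff k n p = 0) :
    p = ∑ n ∈ S, laurentCoeff k n p • LaurentPolynomial.T n := by
  ext m
  change laurentCoeff k m p = laurentCoeff k m _
  rw [map_sum]
  simp only [map_smul, laurentCoeff_T, smul_eq_mul, mul_ite, mul_one, mul_zero,
    Finset.sum_ite_eq']
  split_ifs with h
  · rfl
  · exact hS m h

/-- Only finitely many powers of `t` occur in an element of `k[t, t⁻¹] ⊗ M`. -/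
theorem exists_finset_laurentCoeff {M : Type u} [AddCommGroup M] [Module k M]
    (z : LaurentPolynomial k ⊗[k] M) : ∃ S : Finset ℤ, ∀ n ∉ S, ∀ χ : M →ₗ[k] k,
      laurentCoeff k n (evalRight (LaurentPolynomial k) χ z) = 0 := by
  induction z using TensorProduct.induction_on with
  | zero => exact ⟨∅, fun n _ χ => by simp⟩
  | add x y hx hy =>
    obtain ⟨S, hS⟩ := hx
    obtain ⟨S', hS'⟩ := hy
    refine ⟨S ∪ S', fun n hn χ => ?_⟩
    rw [Finset.notMem_union] at hn
    rw [map_add, map_add, hS n hn.1, hS' n hn.2, add_zero]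
  | tmul p m =>
    refine ⟨p.coeff.support, fun n hn χ => ?_⟩
    have hp : laurentCoeff k n p = 0 := Finsupp.notMem_support_iff.1 hn
    rw [evalRight_tmul, map_smul, hp, smul_zero]

end Laurent

section Pairing

variable {k : Type u} [Field k] {B C R : Type u} [CommRing B] [Algebra k B] [CommRing C]
  [Algebra k C] [CommRing R] [Algebra k R]

/-- The algebra map `B ⊗ C → R`, `b ⊗ c ↦ f b * g c`. -/
noncomputable abbrev pairing (f : B →ₐ[k] R) (g : C →ₐ[k] R) : B ⊗[k] C →ₐ[k] R :=
  Algebra.TensorProduct.lift f g (fun _ _ => .all ..)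

end Pairing

namespace OnePS

variable {k H : Type u} [Field k] [CommRing H] [HopfAlgebra k H] (l : OnePS k H)

/-- The action of `λ` on points in terms of the coaction. -/
theorem act_apply {R : Type u} [CommRing R] [Algebra k R] (x : Rˣ) (g : Points k H R) (h : H) :
    (l.act R x g).ofConv h = pairing (evalT x) g.ofConv (l.coaction h) := by
  have e := l.natural (pairing (evalT x) g.ofConv) (unitT k H)
    (WithConv.toConv Algebra.TensorProduct.includeRight)
  have h1 : Units.map (pairing (evalT x) g.ofConv : LaurentPolynomial k ⊗[k] H →* R)
      (unitT k H) = x := by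
    ext
    simp [unitT, evalT_T]
  have h2 : Points.map (pairing (evalT x) g.ofConv)
      (WithConv.toConv Algebra.TensorProduct.includeRight) = g := by
    apply WithConv.ofConv_injective
    ext a
    simp [Points.map]
  rw [h1, h2] at e
  rw [← e]
  rfl

/-- A functional `χ` on `H` has weight `w` if `χ ∘ λ(t)^* = t ^ w χ`. -/
def HasWeight (χ : H →ₗ[k] k) (w : ℤ) : Prop :=
  ∀ h, evalRight (LaurentPolynomial k) χ (l.coaction h) = χ h • LaurentPolynomial.T w

variable {l}

theorem mem_weightSpace {ξ : LieAlg k H} {w : ℤ} :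
    ξ ∈ l.weightSpace w ↔ l.HasWeight (LieAlg.toDual k H ξ) w := Iff.rfl

theorem HasWeight.sub {χ ψ : H →ₗ[k] k} {w : ℤ} (hχ : l.HasWeight χ w) (hψ : l.HasWeight ψ w) :
    l.HasWeight (χ - ψ) w := by
  intro h
  have e : evalRight (LaurentPolynomial k) (χ - ψ) =
      evalRight (LaurentPolynomial k) χ - evalRight (LaurentPolynomial k) ψ := by
    ext p h
    simp [sub_smul]
  rw [e, LinearMap.sub_apply, hχ, hψ, LinearMap.sub_apply, sub_smul]

/-- Weights add up under convolution, as `λ` acts by group automorphisms. -/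
theorem HasWeight.conv {χ ψ : H →ₗ[k] k} {w v : ℤ} (hχ : l.HasWeight χ w)
    (hψ : l.HasWeight ψ v) : l.HasWeight (conv χ ψ) (w + v) := by
  intro h
  -- compare both sides of `λ(t)(u₁ u₂) = λ(t)(u₁) λ(t)(u₂)` for the universal pair `u₁, u₂`
  let L := LaurentPolynomial k
  let i₁ : H →ₐ[k] H ⊗[k] H := Algebra.TensorProduct.includeLeft
  let i₂ : H →ₐ[k] H ⊗[k] H := Algebra.TensorProduct.includeRight
  let j : H ⊗[k] H →ₐ[k] L ⊗[k] (H ⊗[k] H) := Algebra.TensorProduct.includeRight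
  let u₁ : Points k H (L ⊗[k] (H ⊗[k] H)) := WithConv.toConv (j.comp i₁)
  let u₂ : Points k H (L ⊗[k] (H ⊗[k] H)) := WithConv.toConv (j.comp i₂)
  let F : H ⊗[k] H →ₗ[k] k := LinearMap.mul' k k ∘ₗ TensorProduct.map χ ψ
  have hact (i : H →ₐ[k] H ⊗[k] H) (h : H) :
      (l.act _ (unitT k _) (WithConv.toConv (j.comp i))).ofConv h =
        Algebra.TensorProduct.map (AlgHom.id k L) i (l.coaction h) := by
    rw [act_apply]
    refine DFunLike.congr_fun (Algebra.TensorProduct.ext (laurent_algHom_ext ?_) ?_) _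
    · simp [evalT_T, unitT, L]
    · ext a
      simp [j]
  have e : (l.act _ (unitT k _) (WithConv.toConv (j.comp (Bialgebra.comulAlgHom k H)))).ofConv h =
      pairing (l.act _ (unitT k _) u₁).ofConv (l.act _ (unitT k _) u₂).ofConv
        (Coalgebra.comul (R := k) h) := by
    have h1 : WithConv.toConv (j.comp (Bialgebra.comulAlgHom k H)) = u₁ * u₂ := by
      apply WithConv.ofConv_injective
      ext a
      change 1 ⊗ₜ[k] (Coalgebra.comul (R := k) a) = (u₁ * u₂) a
      rw [AlgHom.convMul_apply]
      induction (Coalgebra.comul (R := k) a) using TensorProduct.induction_on with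
      | zero => simp
      | add x y hx hy => rw [TensorProduct.tmul_add, hx, hy, map_add]
      | tmul b c => simp [u₁, u₂, i₁, i₂, j]
    rw [h1, map_mul]
    exact AlgHom.convMul_apply _ _ _
  have hl (z : L ⊗[k] H) : evalRight L F (Algebra.TensorProduct.map (AlgHom.id k L)
      (Bialgebra.comulAlgHom k H) z) = evalRight L (UHat.conv χ ψ) z := by
    induction z using TensorProduct.induction_on with
    | zero => simp
    | add x y hx hy => simp only [map_add, hx, hy]
    | tmul p a => simp [F, conv_apply]
  have hm (x y : L ⊗[k] H) : evalRight L F (Algebra.TensorProduct.map (AlgHom.id k L) i₁ x *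
      Algebra.TensorProduct.map (AlgHom.id k L) i₂ y) = evalRight L χ x * evalRight L ψ y := by
    induction x using TensorProduct.induction_on with
    | zero => simp
    | add x x' hx hx' => simp only [map_add, add_mul, hx, hx']
    | tmul p a =>
      induction y using TensorProduct.induction_on with
      | zero => simp
      | add y y' hy hy' => simp only [map_add, mul_add, hy, hy']
      | tmul q b => simp [F, i₁, i₂, smul_smul, mul_comm]
  have hr (z : H ⊗[k] H) : evalRight L F (pairing (l.act _ (unitT k _) u₁).ofConv
      (l.act _ (unitT k _) u₂).ofConv z) = F z • LaurentPolynomial.T (w + v) := by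
    induction z using TensorProduct.induction_on with
    | zero => simp
    | add x y hx hy => simp only [map_add, hx, hy, add_smul]
    | tmul a b =>
      rw [Algebra.TensorProduct.lift_tmul, hact, hact, hm, hχ, hψ, smul_mul_smul_comm,
        ← LaurentPolynomial.T_add]
      simp [F]
  rw [← hl, ← hact, e, hr, conv_apply]
  rfl

theorem coaction_counit (h : H) :
    evalRight (LaurentPolynomial k) Coalgebra.counit (l.coaction h) =
      algebraMap k _ (Coalgebra.counit h) := by
  -- automorphisms of `U` preserve the identity element
  let x : (LaurentPolynomial k)ˣ := Units.map
    (Algebra.TensorProduct.rid k k (LaurentPolynomial k) : _ →* LaurentPolynomial k) (unitT k k)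
  have e := DFunLike.congr_fun (congrArg WithConv.ofConv
    (map_one (l.act (LaurentPolynomial k) x))) h
  rw [act_apply] at e
  have hx : evalT (k := k) x = AlgHom.id k (LaurentPolynomial k) :=
    laurent_algHom_ext (by simp [evalT_T, x, unitT])
  have h1 (z : LaurentPolynomial k ⊗[k] H) :
      pairing (evalT x) (1 : Points k H (LaurentPolynomial k)).ofConv z =
        evalRight (LaurentPolynomial k) Coalgebra.counit z := by
    rw [hx]
    induction z using TensorProduct.induction_on with
    | zero => simp
    | add x y hx hy => simp only [map_add, hx, hy]
    | tmul p a =>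
      rw [Algebra.TensorProduct.lift_tmul, evalRight_tmul, Algebra.smul_def, mul_comm]
      rfl
  rw [h1] at e
  exact e

/-- The component of weight `n` of a functional. -/
noncomputable def component (l : OnePS k H) (χ : H →ₗ[k] k) (n : ℤ) : H →ₗ[k] k :=
  laurentCoeff k n ∘ₗ evalRight (LaurentPolynomial k) χ ∘ₗ l.coaction.toLinearMap

theorem component_apply (χ : H →ₗ[k] k) (n : ℤ) (h : H) : l.component χ n h =
    laurentCoeff k n (evalRight (LaurentPolynomial k) χ (l.coaction h)) := rfl

theorem hasWeight_component (χ : H →ₗ[k] k) (n : ℤ) : l.HasWeight (l.component χ n) n := by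
  intro h
  -- compare both sides of `λ(st) = λ(s)λ(t)`
  let j : LaurentPolynomial k ⊗[k] H →ₐ[k]
      LaurentPolynomial k ⊗[k] (LaurentPolynomial k ⊗[k] H) := Algebra.TensorProduct.includeRight
  let u : Points k H (LaurentPolynomial k ⊗[k] (LaurentPolynomial k ⊗[k] H)) :=
    WithConv.toConv (j.comp Algebra.TensorProduct.includeRight)
  let x := unitT k (LaurentPolynomial k ⊗[k] H)
  let y := Units.map (j : LaurentPolynomial k ⊗[k] H →*
    LaurentPolynomial k ⊗[k] (LaurentPolynomial k ⊗[k] H)) (unitT k H)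
  let Φ : LaurentPolynomial k ⊗[k] (LaurentPolynomial k ⊗[k] H) →ₗ[k] LaurentPolynomial k :=
    evalRight (LaurentPolynomial k) (laurentCoeff k n ∘ₗ evalRight (LaurentPolynomial k) χ)
  have h1 : l.act _ y u = WithConv.toConv (j.comp l.coaction) := by
    apply WithConv.ofConv_injective
    ext a
    rw [act_apply]
    have : pairing (R := LaurentPolynomial k ⊗[k] (LaurentPolynomial k ⊗[k] H)) (evalT y)
        u.ofConv = j := by
      refine Algebra.TensorProduct.ext (laurent_algHom_ext
        (R := LaurentPolynomial k ⊗[k] (LaurentPolynomial k ⊗[k] H)) ?_) ?_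
      · simp [evalT_T, y, unitT]
      · ext a
        simp [u]
    rw [this]
    rfl
  have h2 : (l.act _ x (l.act _ y u)).ofConv h =
      Algebra.TensorProduct.map (AlgHom.id k (LaurentPolynomial k)) l.coaction (l.coaction h) := by
    rw [h1, act_apply]
    refine DFunLike.congr_fun (Algebra.TensorProduct.ext (laurent_algHom_ext ?_) ?_) _
    · simp [evalT_T, unitT, x]
    · ext a
      simp [j]
  have h3 (z : LaurentPolynomial k ⊗[k] H) :
      Φ (Algebra.TensorProduct.map (AlgHom.id k (LaurentPolynomial k)) l.coaction z) =
      evalRight (LaurentPolynomial k) (l.component χ n) z := by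
    induction z using TensorProduct.induction_on with
    | zero => simp
    | add x y hx hy => simp only [map_add, hx, hy]
    | tmul p a => simp [Φ, component_apply]
  have h4 (m : ℤ) : (((x * y) ^ m : (LaurentPolynomial k ⊗[k] (LaurentPolynomial k ⊗[k] H))ˣ) :
      LaurentPolynomial k ⊗[k] (LaurentPolynomial k ⊗[k] H)) =
      LaurentPolynomial.T m ⊗ₜ (LaurentPolynomial.T m ⊗ₜ 1) := by
    refine (val_mul_zpow (k := k) Algebra.TensorProduct.includeLeft
      (j.comp Algebra.TensorProduct.includeLeft) ?_ ?_ m).trans ?_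
    · simp [x, unitT]
    · simp [y, unitT]
    · simp [j]
  have h5 (z : LaurentPolynomial k ⊗[k] H) : Φ (pairing (evalT (x * y)) u.ofConv z) =
      laurentCoeff k n (evalRight (LaurentPolynomial k) χ z) • LaurentPolynomial.T n := by
    induction z using TensorProduct.induction_on with
    | zero => simp
    | add x y hx hy => simp only [map_add, hx, hy, add_smul]
    | tmul p a =>
      induction p using laurent_induction with
      | add p q hp hq => simp only [TensorProduct.add_tmul, map_add, hp, hq, add_smul]
      | smul_T m c =>
        rw [← TensorProduct.smul_tmul', map_smul, map_smul, map_smul, map_smul, smul_assoc]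
        congr 1
        rw [Algebra.TensorProduct.lift_tmul, evalT_T, h4]
        simp only [Φ, u, j, AlgHom.comp_apply, Algebra.TensorProduct.includeRight_apply,
          Algebra.TensorProduct.tmul_mul_tmul, mul_one, one_mul, evalRight_tmul,
          LinearMap.comp_apply, map_smul, laurentCoeff_T]
        split_ifs with hmn
        · rw [hmn]
        · simp
  rw [← h3, ← h2, ← MulAut.mul_apply, ← map_mul, act_apply, h5]
  rfl

/-- The component of weight `n` of a point derivation. -/
noncomputable def lieComponent (l : OnePS k H) (ξ : LieAlg k H) (n : ℤ) : LieAlg k H :=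
  ⟨l.component (LieAlg.toDual k H ξ) n, fun a b => by
    simp only [component_apply, map_mul, evalRight_mul, map_add, coaction_counit, mul_comm _
      (algebraMap k (LaurentPolynomial k) _), ← Algebra.smul_def, map_smul, smul_eq_mul]
    ring⟩

theorem toDual_lieComponent (ξ : LieAlg k H) (n : ℤ) :
    LieAlg.toDual k H (l.lieComponent ξ n) = l.component (LieAlg.toDual k H ξ) n := rfl

theorem lieComponent_mem (ξ : LieAlg k H) (n : ℤ) : l.lieComponent ξ n ∈ l.weightSpace n :=
  hasWeight_component _ _

/-- A functional is the sum of its components, since `λ(1)` is the identity. -/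
theorem apply_eq_sum_component (χ : H →ₗ[k] k) (S : Finset ℤ) (h : H)
    (hS : ∀ n ∉ S, l.component χ n h = 0) : χ h = ∑ n ∈ S, l.component χ n h := by
  have e := DFunLike.congr_fun (congrArg WithConv.ofConv (DFunLike.congr_fun
    (map_one (l.act H)) (WithConv.toConv (AlgHom.id k H)))) h
  rw [act_apply] at e
  have h1 (z : LaurentPolynomial k ⊗[k] H) : χ (pairing (evalT 1) (AlgHom.id k H) z) =
      evalT (R := k) 1 (evalRight (LaurentPolynomial k) χ z) := by
    induction z using TensorProduct.induction_on with
    | zero => simp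
    | add x y hx hy => simp only [map_add, hx, hy]
    | tmul p a =>
      induction p using laurent_induction with
      | add p q hp hq => simp only [TensorProduct.add_tmul, map_add, hp, hq]
      | smul_T m c => simp [evalT_T, ← TensorProduct.smul_tmul', mul_comm]
  have h2 : χ h = evalT (R := k) 1 (evalRight (LaurentPolynomial k) χ (l.coaction h)) := by
    rw [← h1]
    exact (congrArg χ e).symm
  rw [h2, eq_sum_laurentCoeff (evalRight (LaurentPolynomial k) χ (l.coaction h)) S hS, map_sum]
  refine Finset.sum_congr rfl fun n _ => ?_
  rw [map_smul, evalT_T, component_apply]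
  simp

end OnePS

/-- A point derivation is determined by its values on generators. -/
theorem lieAlg_eq_zero {k H : Type u} [Field k] [CommRing H] [HopfAlgebra k H] {s : Set H}
    (hs : Algebra.adjoin k s = ⊤) {ξ : LieAlg k H} (h : ∀ a ∈ s, LieAlg.toDual k H ξ a = 0) :
    ξ = 0 := by
  apply Subtype.ext
  ext a
  have ha : a ∈ Algebra.adjoin k s := hs ▸ Algebra.mem_top
  change LieAlg.toDual k H ξ a = 0
  induction ha using Algebra.adjoin_induction with
  | mem x hx => exact h x hx
  | algebraMap r => exact toDual_algebraMap ξ r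
  | add x y _ _ hx hy => rw [map_add, hx, hy, add_zero]
  | mul x y _ _ hx hy => rw [LieAlg.toDual_mul, hx, hy, mul_zero, zero_mul, add_zero]

theorem IsUnipotent.exists_finite_adjoin {k H : Type u} [Field k] [CommRing H] [HopfAlgebra k H]
    (hU : IsUnipotent k H) : ∃ s : Set H, s.Finite ∧ Algebra.adjoin k s = ⊤ := by
  obtain ⟨n, g, _, _, _, hg⟩ := hU
  exact ⟨_, Set.finite_range _, hg⟩

theorem IsUnipotent.finiteDimensional {k H : Type u} [Field k] [CommRing H] [HopfAlgebra k H]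
    (hU : IsUnipotent k H) : FiniteDimensional k (LieAlg k H) := by
  obtain ⟨s, hfin, hs⟩ := hU.exists_finite_adjoin
  have := hfin.to_subtype
  let f : LieAlg k H →ₗ[k] (s → k) :=
    (LinearMap.funLeft k k ((↑) : s → H) ∘ₗ LinearMap.ltoFun k H k k) ∘ₗ LieAlg.toDual k H
  refine FiniteDimensional.of_injective f ((injective_iff_map_eq_zero f).2 fun ξ hξ => ?_)
  exact lieAlg_eq_zero hs fun a ha => congrFun hξ ⟨a, ha⟩

/-- The one-parameter subgroup has finitely many weights on `𝔲`, and `𝔲` is the sum of its weight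
spaces. -/
theorem IsUnipotent.exists_weights {k H : Type u} [Field k] [CommRing H] [HopfAlgebra k H]
    (hU : IsUnipotent k H) (l : OnePS k H) : ∃ S : Finset ℤ, (∀ n ∉ S, l.weightSpace n = ⊥) ∧
      ∀ ξ : LieAlg k H, ξ ∈ ⨆ n, l.weightSpace n := by
  obtain ⟨s, hfin, hs⟩ := hU.exists_finite_adjoin
  choose S hS using fun a : H => exists_finset_laurentCoeff (l.coaction a)
  let S' : Finset ℤ := hfin.toFinset.biUnion S
  have hbot : ∀ n ∉ S', l.weightSpace n = ⊥ := by
    intro n hn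
    rw [eq_bot_iff]
    intro ξ hξ
    refine (Submodule.mem_bot k).2 (lieAlg_eq_zero hs fun a ha => ?_)
    have hna : n ∉ S a := fun h => hn (Finset.mem_biUnion.2 ⟨a, hfin.mem_toFinset.2 ha, h⟩)
    have h := hS a n hna (LieAlg.toDual k H ξ)
    rw [OnePS.mem_weightSpace.1 hξ a, map_smul, laurentCoeff_T, if_pos rfl, smul_eq_mul,
      mul_one] at h
    exact h
  refine ⟨S', hbot, fun ξ => ?_⟩
  have h : ξ = ∑ n ∈ S', l.lieComponent ξ n := by
    apply Subtype.ext
    change LieAlg.toDual k H ξ = LieAlg.toDual k H _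
    rw [map_sum]
    ext h
    rw [LinearMap.sum_apply]
    refine OnePS.apply_eq_sum_component _ S' h fun n hn => ?_
    have h0 : l.lieComponent ξ n = 0 :=
      (Submodule.mem_bot k).1 (hbot n hn ▸ OnePS.lieComponent_mem ξ n)
    rw [← OnePS.toDual_lieComponent, h0, map_zero, LinearMap.zero_apply]
  rw [h]
  exact Submodule.sum_mem _ fun n _ =>
    Submodule.mem_iSup_of_mem n (OnePS.lieComponent_mem ξ n)

end UHat

/-! ### The action on functions -/

namespace UHat

namespace OnePS

namespace Action

variable {k H : Type u} [Field k] [CommRing H] [HopfAlgebra k H] {l : OnePS k H}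
  {A : Type u} [CommRing A] [Algebra k A] (σ : l.Action A)

theorem act_inl_apply {R : Type u} [CommRing R] [Algebra k R] (g : Points k H R) (y : A →ₐ[k] R)
    (a : A) : σ.act R (SemidirectProduct.inl g) y a = pairing g.ofConv y (σ.coactU a) := by
  have e := σ.natural (pairing g.ofConv y)
    (SemidirectProduct.inl (WithConv.toConv Algebra.TensorProduct.includeLeft))
    Algebra.TensorProduct.includeRight
  have h1 : UhatPoints.map l (pairing g.ofConv y)
      (SemidirectProduct.inl (WithConv.toConv Algebra.TensorProduct.includeLeft)) =
        SemidirectProduct.inl g := by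
    apply SemidirectProduct.ext
    · apply WithConv.ofConv_injective
      ext x
      simp [UhatPoints.map, Points.map]
    · simp [UhatPoints.map]
  have h2 : (pairing g.ofConv y).comp Algebra.TensorProduct.includeRight = y := by
    ext b
    simp
  rw [h1, h2] at e
  rw [← e]
  rfl

theorem act_inr_apply {R : Type u} [CommRing R] [Algebra k R] (x : Rˣ) (y : A →ₐ[k] R)
    (a : A) : σ.act R (SemidirectProduct.inr x) y a = pairing (evalT x) y (σ.coactGm a) := by
  have e := σ.natural (pairing (evalT x) y) (SemidirectProduct.inr (unitT k A))
    Algebra.TensorProduct.includeRight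
  have h1 : UhatPoints.map l (pairing (evalT x) y) (SemidirectProduct.inr (unitT k A)) =
      SemidirectProduct.inr x := by
    apply SemidirectProduct.ext
    · apply WithConv.ofConv_injective
      ext b
      exact AlgHom.commutes (pairing (evalT x) y) (Coalgebra.counit (R := k) b)
    · ext
      simp [UhatPoints.map, unitT, evalT_T]
  have h2 : (pairing (evalT x) y).comp Algebra.TensorProduct.includeRight = y := by
    ext b
    simp
  rw [h1, h2] at e
  rw [← e]
  rfl

theorem vectorField_apply (χ : H →ₗ[k] k) (a : A) :
    σ.vectorField χ a = evalLeft A χ (σ.coactU a) := rfl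

/-- The coaction of `U` is coassociative. -/
theorem coactU_coassoc (a : A) :
    TensorProduct.assoc k H H A ((Coalgebra.comul (R := k)).rTensor A (σ.coactU a)) =
      σ.coactU.toLinearMap.lTensor H (σ.coactU a) := by
  -- compare both sides of `(u₁ u₂) y = u₁ (u₂ y)` for the universal points `u₁`, `u₂` and `y`
  let j : H ⊗[k] A →ₐ[k] H ⊗[k] (H ⊗[k] A) := Algebra.TensorProduct.includeRight
  let u₁ : Points k H (H ⊗[k] (H ⊗[k] A)) := WithConv.toConv Algebra.TensorProduct.includeLeft
  let u₂ : Points k H (H ⊗[k] (H ⊗[k] A)) :=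
    WithConv.toConv (j.comp Algebra.TensorProduct.includeLeft)
  let y : A →ₐ[k] H ⊗[k] (H ⊗[k] A) := j.comp Algebra.TensorProduct.includeRight
  have h1 : σ.act _ (SemidirectProduct.inl u₂) y = j.comp σ.coactU := by
    ext b
    rw [act_inl_apply]
    have : pairing (R := H ⊗[k] (H ⊗[k] A)) u₂.ofConv y = j := by
      apply Algebra.TensorProduct.ext
      · ext c
        simp [u₂]
      · ext c
        simp [y]
    rw [this]
    rfl
  have h2 : σ.act _ (SemidirectProduct.inl u₁) (j.comp σ.coactU) a =
      σ.coactU.toLinearMap.lTensor H (σ.coactU a) := by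
    rw [act_inl_apply]
    induction σ.coactU a using TensorProduct.induction_on with
    | zero => simp
    | add x y hx hy => simp only [map_add, hx, hy]
    | tmul h b => simp [u₁, j]
  have h3 : σ.act _ (SemidirectProduct.inl (u₁ * u₂)) y a =
      TensorProduct.assoc k H H A ((Coalgebra.comul (R := k)).rTensor A (σ.coactU a)) := by
    rw [act_inl_apply]
    induction σ.coactU a using TensorProduct.induction_on with
    | zero => simp
    | add x y hx hy => simp only [map_add, hx, hy]
    | tmul h b =>
      have h4 : (u₁ * u₂).ofConv h = pairing u₁.ofConv u₂.ofConv (Coalgebra.comul (R := k) h) :=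
        AlgHom.convMul_apply _ _ _
      rw [Algebra.TensorProduct.lift_tmul, h4, LinearMap.rTensor_tmul]
      induction (Coalgebra.comul (R := k) h) using TensorProduct.induction_on with
      | zero => simp
      | add x y hx hy => simp only [map_add, add_mul, TensorProduct.add_tmul, hx, hy]
      | tmul c d => simp [u₁, u₂, y, j]
  rw [← h2, ← h3, ← h1, map_mul, map_mul]
  rfl

theorem vectorField_conv (χ ψ : H →ₗ[k] k) (a : A) :
    σ.vectorField (conv χ ψ) a = σ.vectorField ψ (σ.vectorField χ a) := by
  have h1 (z : H ⊗[k] A) : evalLeft A (conv χ ψ) z = evalLeft A ψ (evalLeft (H ⊗[k] A) χ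
      (TensorProduct.assoc k H H A ((Coalgebra.comul (R := k)).rTensor A z))) := by
    induction z using TensorProduct.induction_on with
    | zero => simp
    | add x y hx hy => simp only [map_add, hx, hy]
    | tmul h b =>
      rw [evalLeft_tmul, conv_apply, LinearMap.rTensor_tmul]
      induction (Coalgebra.comul (R := k) h) using TensorProduct.induction_on with
      | zero => simp
      | add x y hx hy => simp only [map_add, add_smul, TensorProduct.add_tmul, hx, hy]
      | tmul c d => simp [mul_smul]
  have h2 (z : H ⊗[k] A) : evalLeft A ψ (evalLeft (H ⊗[k] A) χ
      (σ.coactU.toLinearMap.lTensor H z)) = σ.vectorField ψ (evalLeft A χ z) := by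
    induction z using TensorProduct.induction_on with
    | zero => simp
    | add x y hx hy => simp only [map_add, hx, hy]
    | tmul h b => simp [vectorField_apply]
  rw [vectorField_apply, h1, coactU_coassoc, h2]
  rfl

theorem vectorField_counit (a : A) : σ.vectorField Coalgebra.counit a = a := by
  refine Eq.trans ?_ (σ.counit_coactU a)
  rw [vectorField_apply]
  induction σ.coactU a using TensorProduct.induction_on with
  | zero => simp
  | add x y hx hy => simp only [map_add, hx, hy]
  | tmul h b => simp [Algebra.ofId_apply, Algebra.smul_def]

/-- The derivation of `A` defined by a point derivation `ξ ∈ 𝔲`. -/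
noncomputable def derivation (ξ : LieAlg k H) : Derivation k A A :=
  Derivation.mk' (σ.vectorField (LieAlg.toDual k H ξ)) fun a b => σ.vectorField_mul ξ a b

theorem derivation_apply (ξ : LieAlg k H) (a : A) :
    σ.derivation ξ a = σ.vectorField (LieAlg.toDual k H ξ) a := rfl

theorem derivation_add (ξ η : LieAlg k H) (a : A) :
    σ.derivation (ξ + η) a = σ.derivation ξ a + σ.derivation η a := by
  simp [derivation_apply]

theorem derivation_smul (c : k) (ξ : LieAlg k H) (a : A) :
    σ.derivation (c • ξ) a = c • σ.derivation ξ a := by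
  simp [derivation_apply]

theorem derivation_zero (a : A) : σ.derivation 0 a = 0 := by
  simp [derivation_apply]

theorem derivation_bracket (ξ η : LieAlg k H) (a : A) : σ.derivation (bracket ξ η) a =
    σ.derivation η (σ.derivation ξ a) - σ.derivation ξ (σ.derivation η a) := by
  simp only [derivation_apply, toDual_bracket, map_sub, LinearMap.sub_apply, vectorField_conv]

/-- Vector fields of weight `w` raise the weight of functions by `w`. -/
theorem vectorField_mem_weightSpace {χ : H →ₗ[k] k} {w : ℤ} (hχ : l.HasWeight χ w) {v : ℤ} {a : A}
    (ha : a ∈ σ.weightSpace v) : σ.vectorField χ a ∈ σ.weightSpace (v + w) := by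
  -- compare both sides of `t (u y) = λ(t)(u) (t y)` for the universal points `u` and `y`
  let L := LaurentPolynomial k
  let j : H ⊗[k] A →ₐ[k] L ⊗[k] (H ⊗[k] A) := Algebra.TensorProduct.includeRight
  let u : Points k H (L ⊗[k] (H ⊗[k] A)) :=
    WithConv.toConv (j.comp Algebra.TensorProduct.includeLeft)
  let y : A →ₐ[k] L ⊗[k] (H ⊗[k] A) := j.comp Algebra.TensorProduct.includeRight
  let x : (L ⊗[k] (H ⊗[k] A))ˣ := unitT k (H ⊗[k] A)
  have hx : evalT x = (Algebra.TensorProduct.includeLeft : L →ₐ[k] L ⊗[k] (H ⊗[k] A)) :=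
    laurent_algHom_ext (by rw [evalT_T]; simp [x, unitT])
  have hgrp : (SemidirectProduct.inr x * SemidirectProduct.inl u : l.UhatPoints _) =
      SemidirectProduct.inl (l.act _ x u) * SemidirectProduct.inr x := by
    rw [SemidirectProduct.inl_aut, map_inv, inv_mul_cancel_right]
  have e : σ.act _ (SemidirectProduct.inr x) (σ.act _ (SemidirectProduct.inl u) y) a =
      σ.act _ (SemidirectProduct.inl (l.act _ x u)) (σ.act _ (SemidirectProduct.inr x) y) a := by
    rw [← Equiv.Perm.mul_apply, ← Equiv.Perm.mul_apply, ← map_mul, ← map_mul, hgrp]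
  have h1 : σ.act _ (SemidirectProduct.inl u) y = j.comp σ.coactU := by
    ext b
    rw [act_inl_apply]
    have : pairing (R := L ⊗[k] (H ⊗[k] A)) u.ofConv y = j := by
      apply Algebra.TensorProduct.ext
      · ext c
        simp [u]
      · ext c
        simp [y]
    rw [this]
    rfl
  have ha' : σ.coactGm a = LaurentPolynomial.T (-v) ⊗ₜ a := ha
  have h2 (b : A) : σ.act _ (SemidirectProduct.inr x) y b =
      Algebra.TensorProduct.map (AlgHom.id k L) Algebra.TensorProduct.includeRight
        (σ.coactGm b) := by
    rw [act_inr_apply, hx]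
    refine DFunLike.congr_fun (Algebra.TensorProduct.ext ?_ ?_) _
    · ext c
      simp
      rfl
    · ext c
      simp [y, j]
  have h3 (h : H) : (l.act _ x u).ofConv h =
      Algebra.TensorProduct.map (AlgHom.id k L) Algebra.TensorProduct.includeLeft
        (l.coaction h) := by
    rw [act_apply, hx]
    refine DFunLike.congr_fun (Algebra.TensorProduct.ext ?_ ?_) _
    · ext c
      simp
      rfl
    · ext c
      simp [u, j]
  rw [h1, act_inr_apply, hx, ha', act_inl_apply, Algebra.TensorProduct.lift_tmul] at e
  let Φ : L ⊗[k] (H ⊗[k] A) →ₗ[k] L ⊗[k] A := (evalLeft A χ).lTensor L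
  have h4 (s : L ⊗[k] H) (t : L ⊗[k] A) :
      Φ (Algebra.TensorProduct.map (AlgHom.id k L) Algebra.TensorProduct.includeLeft s *
        Algebra.TensorProduct.map (AlgHom.id k L) Algebra.TensorProduct.includeRight t) =
      (evalRight L χ s ⊗ₜ 1) * t := by
    induction s using TensorProduct.induction_on with
    | zero => simp
    | add s s' hs hs' => simp only [map_add, add_mul, TensorProduct.add_tmul, hs, hs']
    | tmul p h =>
      induction t using TensorProduct.induction_on with
      | zero => simp
      | add t t' ht ht' => simp only [map_add, mul_add, ht, ht']
      | tmul q b => simp [Φ, TensorProduct.smul_tmul']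
  have h5 (z : H ⊗[k] A) : Φ (pairing (l.act _ x u).ofConv
      (σ.act _ (SemidirectProduct.inr x) y) z) =
        (LaurentPolynomial.T w ⊗ₜ 1) * σ.coactGm (evalLeft A χ z) := by
    induction z using TensorProduct.induction_on with
    | zero => simp
    | add s t hs ht => simp only [map_add, hs, ht, mul_add]
    | tmul h b =>
      rw [Algebra.TensorProduct.lift_tmul, h2, h3, h4, hχ, evalLeft_tmul, map_smul,
        ← TensorProduct.smul_tmul', smul_mul_assoc, mul_smul_comm]
  have e' := congrArg Φ e
  rw [h5] at e'
  have h6 : Φ ((Algebra.TensorProduct.includeLeft : L →ₐ[k] L ⊗[k] (H ⊗[k] A))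
      (LaurentPolynomial.T (-v)) * (j.comp σ.coactU) a) =
        LaurentPolynomial.T (-v) ⊗ₜ σ.vectorField χ a := by
    simp [Φ, j, vectorField_apply]
  have e'' := congrArg ((LaurentPolynomial.T (-w) ⊗ₜ[k] (1 : A)) * ·) (h6.symm.trans e')
  simp only [← mul_assoc, Algebra.TensorProduct.tmul_mul_tmul, ← LaurentPolynomial.T_add, one_mul,
    neg_add_cancel] at e''
  rw [LaurentPolynomial.T_zero, ← Algebra.TensorProduct.one_def, one_mul] at e''
  change σ.coactGm _ = _
  rw [TensorProduct.mk_apply, vectorField_apply, ← e'', neg_add_rev]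
  rfl

theorem mul_mem_weightSpace {v w : ℤ} {a b : A} (ha : a ∈ σ.weightSpace v)
    (hb : b ∈ σ.weightSpace w) : a * b ∈ σ.weightSpace (v + w) := by
  have ha' : σ.coactGm a = LaurentPolynomial.T (-v) ⊗ₜ a := ha
  have hb' : σ.coactGm b = LaurentPolynomial.T (-w) ⊗ₜ b := hb
  change σ.coactGm _ = _
  rw [map_mul, ha', hb', Algebra.TensorProduct.tmul_mul_tmul, ← LaurentPolynomial.T_add, neg_add]
  rfl

theorem one_mem_weightSpace : (1 : A) ∈ σ.weightSpace 0 := by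
  change σ.coactGm _ = _
  rw [map_one, TensorProduct.mk_apply, neg_zero, LaurentPolynomial.T_zero]
  rfl

/-- The projection of `A` onto the weight space `A_{λ = v}`. -/
noncomputable def proj (v : ℤ) : A →ₗ[k] A :=
  evalLeft A (laurentCoeff k (-v)) ∘ₗ σ.coactGm.toLinearMap

theorem proj_of_mem {v w : ℤ} {a : A} (ha : a ∈ σ.weightSpace w) :
    σ.proj v a = if w = v then a else 0 := by
  have ha' : σ.coactGm a = LaurentPolynomial.T (-w) ⊗ₜ a := ha
  rw [proj, LinearMap.comp_apply, AlgHom.toLinearMap_apply, ha', evalLeft_tmul, laurentCoeff_T]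
  simp [neg_inj]

/-- A function annihilated by all of `𝔲` is invariant under the unipotent group `U`. -/
theorem mem_invariants_iff [CharZero k] (hU : IsUnipotent k H) (a : A) :
    a ∈ σ.invariants ↔ ∀ ξ : LieAlg k H, σ.derivation ξ a = 0 := by
  have hmem : a ∈ σ.invariants ↔ σ.coactU a = 1 ⊗ₜ a := Iff.rfl
  rw [hmem]
  constructor
  · intro h ξ
    rw [derivation_apply, vectorField_apply, h, evalLeft_tmul, toDual_one, zero_smul]
  · intro h
    -- every matrix coefficient of the orbit map is annihilated by the invariant vector fields
    have key (f : A →ₗ[k] k) : evalRight H f (σ.coactU a) = algebraMap k H (f a) := by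
      have h1 : ∀ ξ : LieAlg k H, evalLeft H (LieAlg.toDual k H ξ)
          (Coalgebra.comul (evalRight H f (σ.coactU a))) = 0 := by
        intro ξ
        refine (Module.forall_dual_apply_eq_zero_iff k _).1 fun χ => ?_
        rw [← conv_eq_evalLeft, eval_comm, ← vectorField_apply, vectorField_conv,
          ← derivation_apply, h ξ, map_zero, map_zero]
      rw [hU.eq_algebraMap h1, eval_comm, ← vectorField_apply, vectorField_counit]
    refine sub_eq_zero.1 (evalRight_separates fun f => ?_)
    rw [map_sub, key, evalRight_tmul, Algebra.algebraMap_eq_smul_one, sub_self]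

end Action
end OnePS
end UHat

/-! ### The slice tower of an action with constant cokernels -/

namespace UHat

namespace OnePS

theorem lieGE_le_sup {k H : Type u} [Field k] [CommRing H] [HopfAlgebra k H] (l : OnePS k H)
    (w : ℤ) : l.lieGE w ≤ l.weightSpace w ⊔ l.lieGT w := by
  refine iSup₂_le fun v hv => ?_
  rcases hv.eq_or_lt with rfl | hv
  · exact le_sup_left
  · exact le_sup_of_le_right (le_iSup₂_of_le v hv le_rfl)

theorem lieGT_le_lieGE {k H : Type u} [Field k] [CommRing H] [HopfAlgebra k H] (l : OnePS k H)
    (w : ℤ) : l.lieGT w ≤ l.lieGE w :=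
  iSup₂_le fun v hv => le_iSup₂_of_le v hv.le le_rfl

theorem weightSpace_le_lieGE {k H : Type u} [Field k] [CommRing H] [HopfAlgebra k H]
    (l : OnePS k H) (w : ℤ) : l.weightSpace w ≤ l.lieGE w :=
  le_iSup₂_of_le w le_rfl le_rfl

theorem lieGE_eq_lieGT_sub_one {k H : Type u} [Field k] [CommRing H] [HopfAlgebra k H]
    (l : OnePS k H) (w : ℤ) : l.lieGE w = l.lieGT (w - 1) := by
  simp only [lieGE, lieGT, Int.sub_one_lt_iff]

theorem bracket_mem_weightSpace {k H : Type u} [Field k] [CommRing H] [HopfAlgebra k H]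
    {l : OnePS k H} {ξ η : LieAlg k H} {v w : ℤ} (hξ : ξ ∈ l.weightSpace v)
    (hη : η ∈ l.weightSpace w) : bracket ξ η ∈ l.weightSpace (v + w) := by
  rw [mem_weightSpace, toDual_bracket]
  exact HasWeight.sub (HasWeight.conv hξ hη) (add_comm v w ▸ HasWeight.conv hη hξ)

namespace Action

variable {k H : Type u} [Field k] [CommRing H] [HopfAlgebra k H] {l : OnePS k H}
  {A : Type u} [CommRing A] [Algebra k A] (σ : l.Action A)

/-- The algebra `A` is graded by the non-positive weights. -/
def IsNonposGraded : Prop := DirectSum.IsInternal (fun w : {w : ℤ // w ≤ 0} => σ.weightSpace w)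

variable {σ}

namespace IsNonposGraded

theorem induction (hA : σ.IsNonposGraded) {M : A → Prop} (a : A)
    (mem : ∀ v ≤ 0, ∀ a ∈ σ.weightSpace v, M a) (add : ∀ a b, M a → M b → M (a + b)) : M a := by
  have ha : a ∈ ⨆ w : {w : ℤ // w ≤ 0}, σ.weightSpace w := by
    rw [hA.submodule_iSup_eq_top]
    trivial
  exact Submodule.iSup_induction _ (motive := M) ha (fun v a hv => mem v v.2 a hv)
    (mem 0 le_rfl 0 (zero_mem _)) add

theorem proj_mem (hA : σ.IsNonposGraded) (v : ℤ) (a : A) : σ.proj v a ∈ σ.weightSpace v := by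
  induction a using hA.induction with
  | mem w _ a ha =>
    rw [σ.proj_of_mem ha]
    split_ifs with h
    · exact h ▸ ha
    · exact zero_mem _
  | add a b ha hb =>
    rw [map_add]
    exact add_mem ha hb

theorem eq_zero_of_pos (hA : σ.IsNonposGraded) {v : ℤ} (hv : 0 < v) {a : A}
    (ha : a ∈ σ.weightSpace v) : a = 0 := by
  have h : σ.proj v a = 0 := by
    clear ha
    induction a using hA.induction with
    | mem w hw a ha => rw [σ.proj_of_mem ha, if_neg (by omega)]
    | add a b ha hb => rw [map_add, ha, hb, add_zero]
  rw [σ.proj_of_mem ha, if_pos rfl] at h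
  exact h

/-- The projection to weight `0` is multiplicative, as its kernel is an ideal. -/
theorem proj_zero_mul (hA : σ.IsNonposGraded) (a b : A) :
    σ.proj 0 (a * b) = σ.proj 0 a * σ.proj 0 b := by
  induction a using hA.induction with
  | mem v hv a ha =>
    induction b using hA.induction with
    | mem w hw b hb =>
      rw [σ.proj_of_mem ha, σ.proj_of_mem hb, σ.proj_of_mem (σ.mul_mem_weightSpace ha hb)]
      rcases hv.eq_or_lt with rfl | hv
      · simp
      · rw [if_neg (by omega), if_neg (by omega), zero_mul]
    | add b c hb hc => rw [mul_add, map_add, map_add, mul_add, hb, hc]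
  | add a c ha hc => rw [add_mul, map_add, map_add, add_mul, ha, hc]

theorem derivation_mem {ξ : LieAlg k H} {w v : ℤ} (hξ : ξ ∈ l.weightSpace w) {a : A}
    (ha : a ∈ σ.weightSpace v) : σ.derivation ξ a ∈ σ.weightSpace (v + w) :=
  σ.vectorField_mem_weightSpace (mem_weightSpace.1 hξ) ha

theorem derivation_proj (hA : σ.IsNonposGraded) {ξ : LieAlg k H} {w : ℤ}
    (hξ : ξ ∈ l.weightSpace w) (v : ℤ) (a : A) :
    σ.derivation ξ (σ.proj v a) = σ.proj (v + w) (σ.derivation ξ a) := by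
  induction a using hA.induction with
  | mem v' _ a ha =>
    rw [σ.proj_of_mem ha, σ.proj_of_mem (derivation_mem hξ ha)]
    by_cases h : v' = v
    · rw [if_pos h, if_pos (by rw [h])]
    · rw [if_neg h, if_neg (by omega), map_zero]
  | add a b ha hb => simp only [map_add, ha, hb]

theorem isLocallyNilpotent (hA : σ.IsNonposGraded) {ξ : LieAlg k H} {w : ℤ} (hw : 0 < w)
    (hξ : ξ ∈ l.weightSpace w) : SliceTower.IsLocallyNilpotent (σ.derivation ξ) := by
  intro a
  induction a using hA.induction with
  | mem v hv a ha =>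
    have h : ∀ n : ℕ, (σ.derivation ξ)^[n] a ∈ σ.weightSpace (v + n * w) := by
      intro n
      induction n with
      | zero => simpa using ha
      | succ n ih =>
        rw [Function.iterate_succ_apply']
        have e : v + ((n + 1 : ℕ) : ℤ) * w = v + n * w + w := by
          push_cast
          ring
        rw [e]
        exact derivation_mem hξ ih
    refine ⟨(-v).toNat + 1, hA.eq_zero_of_pos ?_ (h _)⟩
    push_cast
    rw [Int.toNat_of_nonneg (by omega)]
    nlinarith
  | add a b ha hb =>
    obtain ⟨n, hn⟩ := ha
    obtain ⟨m, hm⟩ := hb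
    refine ⟨max n m, ?_⟩
    have h (i : ℕ) : (σ.derivation ξ)^[i] (a + b) =
        (σ.derivation ξ)^[i] a + (σ.derivation ξ)^[i] b := iterate_map_add _ _ _ _
    rw [h, SliceTower.iterate_eq_zero_of_le _ hn (le_max_left _ _),
      SliceTower.iterate_eq_zero_of_le _ hm (le_max_right _ _), add_zero]

end IsNonposGraded

variable (σ) in
/-- The subalgebra of functions annihilated by a subspace of `𝔲`. -/
noncomputable def annihilated (𝔳 : Submodule k (LieAlg k H)) : Subalgebra k A :=
  ⨅ ξ ∈ 𝔳, SliceTower.constants (σ.derivation ξ)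

theorem mem_annihilated {𝔳 : Submodule k (LieAlg k H)} {a : A} :
    a ∈ σ.annihilated 𝔳 ↔ ∀ ξ ∈ 𝔳, σ.derivation ξ a = 0 := by
  simp [annihilated, Algebra.mem_iInf, SliceTower.mem_constants]

variable (σ) in
/-- The subspace of the elements of `𝔲` that annihilate a function. -/
noncomputable def annihilator (a : A) : Submodule k (LieAlg k H) where
  carrier := {ξ | σ.derivation ξ a = 0}
  zero_mem' := σ.derivation_zero a
  add_mem' := by
    intro ξ η hξ hη
    rw [Set.mem_ofPred_eq] at hξ hη ⊢
    rw [derivation_add, hξ, hη, add_zero]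
  smul_mem' := by
    intro c ξ hξ
    rw [Set.mem_ofPred_eq] at hξ ⊢
    rw [derivation_smul, hξ, smul_zero]

theorem mem_annihilated_iff_le {𝔳 : Submodule k (LieAlg k H)} {a : A} :
    a ∈ σ.annihilated 𝔳 ↔ 𝔳 ≤ σ.annihilator a := mem_annihilated

theorem mem_annihilated_lieGT {w : ℤ} {a : A} : a ∈ σ.annihilated (l.lieGT w) ↔
    ∀ v, w < v → ∀ ξ ∈ l.weightSpace v, σ.derivation ξ a = 0 := by
  rw [mem_annihilated_iff_le, lieGT, iSup₂_le_iff]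
  rfl

theorem proj_mem_annihilated (hA : σ.IsNonposGraded) {w : ℤ} {a : A}
    (ha : a ∈ σ.annihilated (l.lieGT w)) (v : ℤ) : σ.proj v a ∈ σ.annihilated (l.lieGT w) := by
  rw [mem_annihilated_lieGT] at ha ⊢
  intro v' hv' ξ hξ
  rw [hA.derivation_proj hξ, ha v' hv' ξ hξ, map_zero]

theorem mem_annihilated_of_weight_zero (hA : σ.IsNonposGraded) {w : ℤ} (hw : 0 ≤ w) {a : A}
    (ha : a ∈ σ.weightSpace 0) : a ∈ σ.annihilated (l.lieGT w) := by
  rw [mem_annihilated_lieGT]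
  intro v hv ξ hξ
  exact hA.eq_zero_of_pos (v := 0 + v) (by omega) (IsNonposGraded.derivation_mem hξ ha)

/-- The elements of weight `w > 0` preserve the functions annihilated by the larger weights, because
the bracket increases weights. -/
theorem derivation_mem_annihilated {w : ℤ} (hw : 0 < w) {ξ : LieAlg k H}
    (hξ : ξ ∈ l.weightSpace w) {a : A} (ha : a ∈ σ.annihilated (l.lieGT w)) :
    σ.derivation ξ a ∈ σ.annihilated (l.lieGT w) := by
  rw [mem_annihilated_lieGT] at ha ⊢
  intro v hv η hη
  have h := σ.derivation_bracket ξ η a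
  rw [ha (w + v) (by omega) _ (bracket_mem_weightSpace hξ hη), ha v hv η hη, map_zero,
    sub_zero] at h
  exact h.symm

theorem derivation_comm {w : ℤ} (hw : 0 < w) {ξ η : LieAlg k H}
    (hξ : ξ ∈ l.weightSpace w) (hη : η ∈ l.weightSpace w) {a : A}
    (ha : a ∈ σ.annihilated (l.lieGT w)) :
    σ.derivation ξ (σ.derivation η a) = σ.derivation η (σ.derivation ξ a) := by
  have h := σ.derivation_bracket ξ η a
  rw [mem_annihilated_lieGT.1 ha (w + w) (by omega) _ (bracket_mem_weightSpace hξ hη)] at h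
  exact (sub_eq_zero.1 h.symm).symm

theorem infAction_apply (𝔳 : Submodule k (LieAlg k H)) (ω : Ω[A⁄k]) (ξ : 𝔳) :
    σ.infAction 𝔳 ω ξ = (σ.derivation ξ).liftKaehlerDifferential ω := by
  have hω : ω ∈ Submodule.span A (Set.range (KaehlerDifferential.D k A)) := by
    rw [KaehlerDifferential.span_range_derivation]
    trivial
  induction hω using Submodule.span_induction with
  | mem x hx =>
    obtain ⟨a, rfl⟩ := hx
    rw [Derivation.liftKaehlerDifferential_comp_D]
    simp only [infAction, LinearMap.comp_apply, Derivation.liftKaehlerDifferential_comp_D]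
    rfl
  | zero => simp
  | add x y _ _ hx hy => rw [map_add, map_add, LinearMap.add_apply, hx, hy]
  | smul a x _ hx => rw [map_smul, map_smul, LinearMap.smul_apply, hx]

theorem relInfAction_mk {𝔳 𝔴 : Submodule k (LieAlg k H)} (κ : LinearMap.ker (σ.infAction 𝔴))
    (ξ : 𝔳) : σ.relInfAction 𝔳 𝔴 κ (Submodule.Quotient.mk ξ) =
      (σ.derivation ξ).liftKaehlerDifferential κ :=
  infAction_apply (σ := σ) 𝔳 κ.1 ξ

/-- Taking parts of weight zero, the values of a differential form on `𝔲_{λ = w}` become the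
derivatives of a function. -/
theorem exists_derivation_eq_proj (hA : σ.IsNonposGraded) {w : ℤ} (hw : 0 < w) {ω : Ω[A⁄k]}
    (hω : ω ∈ Submodule.span A (KaehlerDifferential.D k A '' σ.annihilated (l.lieGT w))) :
    ∃ x ∈ σ.annihilated (l.lieGT w), ∀ ξ ∈ l.weightSpace w,
      σ.derivation ξ x = σ.proj 0 ((σ.derivation ξ).liftKaehlerDifferential ω) := by
  induction hω using Submodule.span_induction with
  | mem ω hω =>
    obtain ⟨b, hb, rfl⟩ := hω
    refine ⟨σ.proj (-w) b, proj_mem_annihilated hA hb _, fun ξ hξ => ?_⟩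
    rw [hA.derivation_proj hξ, Derivation.liftKaehlerDifferential_comp_D, neg_add_cancel]
  | zero => exact ⟨0, zero_mem _, fun ξ _ => by simp⟩
  | add ω ω' _ _ h h' =>
    obtain ⟨x, hx, hx'⟩ := h
    obtain ⟨y, hy, hy'⟩ := h'
    exact ⟨x + y, add_mem hx hy, fun ξ hξ => by
      rw [map_add, map_add, map_add, hx' ξ hξ, hy' ξ hξ]⟩
  | smul a ω _ h =>
    obtain ⟨x, hx, hx'⟩ := h
    have ha := hA.proj_mem 0 a
    refine ⟨σ.proj 0 a * x, mul_mem (mem_annihilated_of_weight_zero hA hw.le ha) hx,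
      fun ξ hξ => ?_⟩
    have h0 : σ.derivation ξ (σ.proj 0 a) = 0 :=
      hA.eq_zero_of_pos (v := 0 + w) (by omega) (IsNonposGraded.derivation_mem hξ ha)
    rw [Derivation.leibniz, h0, smul_zero, add_zero, hx' ξ hξ, map_smul, smul_eq_mul, smul_eq_mul,
      hA.proj_zero_mul]

/-- If the cokernel of `φ : K → (𝔳 / 𝔴)^* ⊗ A` is constant, there are elements of `𝔳 / 𝔴` on which
forms in `K` take arbitrary constant values and which detect the vanishing of the
forms in `K`: a basis of the kernel of `𝔳 / 𝔴 → 𝔰`. -/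
theorem HasConstantCokernel.exists_basis {𝔳 𝔴 : Submodule k (LieAlg k H)}
    [FiniteDimensional k (LieAlg k H)] (h : σ.HasConstantCokernel 𝔳 𝔴) :
    ∃ (r : ℕ) (v : Fin r → 𝔳 ⧸ 𝔴.submoduleOf 𝔳),
      (∃ κ : Fin r → LinearMap.ker (σ.infAction 𝔴),
        ∀ i j, σ.relInfAction 𝔳 𝔴 (κ j) (v i) = if i = j then 1 else 0) ∧
      ∀ κ, (∀ i, σ.relInfAction 𝔳 𝔴 κ (v i) = 0) → σ.relInfAction 𝔳 𝔴 κ = 0 := by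
  obtain ⟨𝔰, _, _, q, hq, hinj, hsurj⟩ := h
  let b := Module.finBasis k (LinearMap.ker q)
  refine ⟨_, fun i => b i, ?_, ?_⟩
  · have key (j) : ∃ κ : LinearMap.ker (σ.infAction 𝔴), ∀ i,
        σ.relInfAction 𝔳 𝔴 κ (b i) = if i = j then 1 else 0 := by
      obtain ⟨g, hg⟩ := LinearMap.exists_extend (b.coord j)
      obtain ⟨s, hs⟩ := hsurj ((LinearMap.range (σ.relInfAction 𝔳 𝔴)).mkQ
        (Algebra.linearMap k A ∘ₗ g))
      obtain ⟨κ, hκ⟩ := (Submodule.Quotient.eq _).1 hs.symm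
      refine ⟨κ, fun i => ?_⟩
      have hgi : g (b i) = if i = j then 1 else 0 := by
        have := LinearMap.congr_fun hg (b i)
        rw [LinearMap.comp_apply, Submodule.subtype_apply] at this
        rw [this, Module.Basis.coord_apply, Module.Basis.repr_self, Finsupp.single_apply]
      have hqi : q (b i) = 0 := (b i).2
      rw [hκ, LinearMap.sub_apply, LinearMap.comp_apply, hgi]
      simp [hqi]
    choose κ hκ using key
    exact ⟨κ, fun i j => hκ j i⟩
  · intro κ hκ
    set f := σ.relInfAction 𝔳 𝔴 κ with hf
    obtain ⟨s, hs⟩ := q.exists_rightInverse_of_surjective (LinearMap.range_eq_top.2 hq)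
    have hker : LinearMap.ker q ≤ LinearMap.ker f := by
      intro v hv
      have : f ∘ₗ (LinearMap.ker q).subtype = 0 := b.ext hκ
      exact LinearMap.congr_fun this ⟨v, hv⟩
    have hfq : LinearMap.lcomp A A q (f ∘ₗ s) = f := by
      refine LinearMap.ext fun v => ?_
      have hv : v - s (q v) ∈ LinearMap.ker q := by
        rw [LinearMap.mem_ker, map_sub]
        exact sub_eq_zero.2 (LinearMap.congr_fun hs (q v)).symm
      have := hker hv
      rw [LinearMap.mem_ker, map_sub, sub_eq_zero] at this
      exact this.symm
    have h0 : f ∘ₗ s = 0 := by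
      apply hinj
      rw [map_zero, LinearMap.comp_apply, hfq]
      exact (Submodule.Quotient.mk_eq_zero _).2 ⟨κ, rfl⟩
    rw [← hfq, h0, map_zero]

/-- The slice tower over the functions annihilated by `𝔲_{λ > w}` extends to the functions
annihilated by `𝔲_{λ ≥ w}`. -/
theorem isSliceTower_lieGE [CharZero k] [FiniteDimensional k (LieAlg k H)] (hA : σ.IsNonposGraded)
    {w : ℤ} (hw : 0 < w) (hc : σ.HasConstantCokernel (l.lieGE w) (l.lieGT w))
    (h : SliceTower.IsSliceTower (σ.derivation '' l.lieGT w) (σ.annihilated (l.lieGT w))) :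
    SliceTower.IsSliceTower (σ.derivation '' l.lieGE w) (σ.annihilated (l.lieGE w)) := by
  set B := σ.annihilated (l.lieGT w) with hB
  obtain ⟨r, v, ⟨κ, hκ⟩, hdet⟩ := hc.exists_basis
  have hlift (i : Fin r) : ∃ ξ : LieAlg k H, ∃ hξ : ξ ∈ l.weightSpace w,
      Submodule.Quotient.mk ⟨ξ, l.weightSpace_le_lieGE w hξ⟩ = v i := by
    obtain ⟨⟨η, hη⟩, hηv⟩ := Submodule.Quotient.mk_surjective _ (v i)
    obtain ⟨ξ, hξ, ζ, hζ, rfl⟩ := Submodule.mem_sup.1 (l.lieGE_le_sup w hη)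
    refine ⟨ξ, hξ, ?_⟩
    rw [← hηv, Submodule.Quotient.eq]
    change ξ - (ξ + ζ) ∈ l.lieGT w
    rw [sub_add_cancel_left]
    exact neg_mem hζ
  choose ξ hξ hξv using hlift
  have hslice (j : Fin r) : ∃ x ∈ B, ∀ i, σ.derivation (ξ i) x = if i = j then 1 else 0 := by
    have hker : ∀ D ∈ σ.derivation '' l.lieGT w,
        D.liftKaehlerDifferential (κ j : Ω[A⁄k]) = 0 := by
      rintro _ ⟨ζ, hζ, rfl⟩
      rw [← infAction_apply (l.lieGT w) (κ j : Ω[A⁄k]) ⟨ζ, hζ⟩, LinearMap.mem_ker.1 (κ j).2,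
        LinearMap.zero_apply]
    obtain ⟨x, hx, hx'⟩ := exists_derivation_eq_proj hA hw
      (h.mem_span_of_forall_eq_zero _ hker)
    refine ⟨x, hx, fun i => ?_⟩
    have h1 := hκ i j
    rw [← hξv, relInfAction_mk] at h1
    rw [hx' _ (hξ i), h1]
    split_ifs
    · rw [σ.proj_of_mem σ.one_mem_weightSpace, if_pos rfl]
    · exact map_zero _
  choose x hxB hx using hslice
  have hmem (s : Finset (Fin r)) (b : A) :
      b ∈ B ⊓ s.inf (fun i => SliceTower.constants (σ.derivation (ξ i))) ↔
        b ∈ B ∧ ∀ i ∈ s, σ.derivation (ξ i) b = 0 := by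
    rw [Finset.inf_eq_iInf, Algebra.mem_inf]
    simp [Algebra.mem_iInf, SliceTower.mem_constants]
  have key (s : Finset (Fin r)) : SliceTower.IsSliceTower (σ.derivation '' l.lieGE w)
      (B ⊓ s.inf (fun i => SliceTower.constants (σ.derivation (ξ i)))) := by
    induction s using Finset.induction with
    | empty =>
      rw [Finset.inf_empty, inf_top_eq]
      exact h.mono (Set.image_mono (l.lieGT_le_lieGE w))
    | insert i s his ih =>
      rw [Finset.inf_insert, inf_comm (SliceTower.constants (σ.derivation (ξ i))), ← inf_assoc]
      refine .step _ (x i) ih ⟨ξ i, l.weightSpace_le_lieGE w (hξ i), rfl⟩ (fun b hb => ?_)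
        (hA.isLocallyNilpotent hw (hξ i)) ?_ ?_
      · rw [hmem] at hb ⊢
        refine ⟨derivation_mem_annihilated hw (hξ i) hb.1, fun j hj => ?_⟩
        rw [derivation_comm hw (hξ j) (hξ i) hb.1, hb.2 j hj, map_zero]
      · rw [hmem]
        refine ⟨hxB i, fun j hj => ?_⟩
        rw [hx, if_neg]
        rintro rfl
        exact his hj
      · rw [hx, if_pos rfl]
  convert key Finset.univ using 1
  ext b
  rw [hmem]
  constructor
  · intro hb
    rw [mem_annihilated] at hb
    refine ⟨mem_annihilated.2 fun ζ hζ => hb ζ (l.lieGT_le_lieGE w hζ), fun i _ => ?_⟩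
    exact hb _ (l.weightSpace_le_lieGE w (hξ i))
  · rintro ⟨hbB, hb⟩
    have hbκ : KaehlerDifferential.D k A b ∈ LinearMap.ker (σ.infAction (l.lieGT w)) := by
      rw [LinearMap.mem_ker]
      ext ζ
      rw [infAction_apply, Derivation.liftKaehlerDifferential_comp_D]
      exact mem_annihilated.1 hbB ζ ζ.2
    have h0 := hdet ⟨_, hbκ⟩ fun i => by
      rw [← hξv, relInfAction_mk, Derivation.liftKaehlerDifferential_comp_D]
      exact hb i (Finset.mem_univ i)
    rw [mem_annihilated]
    intro ζ hζ
    have h1 := LinearMap.congr_fun h0 (Submodule.Quotient.mk ⟨ζ, hζ⟩)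
    rw [relInfAction_mk, Derivation.liftKaehlerDifferential_comp_D] at h1
    exact h1

/-- The invariants of an action satisfying the CDRS condition are the end of a slice tower of
derivations from `𝔲`. -/
theorem IsAffineCDRS.isSliceTower [CharZero k] (hU : IsUnipotent k H) (hl : l.IsGrading)
    (hσ : σ.IsAffineCDRS) :
    SliceTower.IsSliceTower (Set.range σ.derivation) σ.invariants := by
  have := hU.finiteDimensional
  have hA : σ.IsNonposGraded := hσ.1
  obtain ⟨S, hS, htop⟩ := hU.exists_weights l
  obtain ⟨N, hN⟩ := S.bddAbove
  have hbot : l.lieGT (max N 0) = ⊥ := by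
    rw [eq_bot_iff]
    refine iSup₂_le fun v hv => ?_
    rw [hS v fun h => absurd (hN h) (by omega)]
  have hzero : l.lieGT 0 = ⊤ := by
    rw [eq_top_iff]
    rintro ξ -
    refine (iSup_le fun v => ?_ : ⨆ v, l.weightSpace v ≤ l.lieGT 0) (htop ξ)
    by_cases hv : l.IsWeight v
    · exact le_iSup₂_of_le v (hl v hv) le_rfl
    · rw [not_not.1 hv]
      exact bot_le
  have key : ∀ w ≤ max N 0,
      SliceTower.IsSliceTower (σ.derivation '' l.lieGT w) (σ.annihilated (l.lieGT w)) := by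
    intro w hw
    induction w, hw using Int.leInductionDown with
    | base =>
      have : σ.annihilated (l.lieGT (max N 0)) = ⊤ := by
        rw [eq_top_iff, hbot]
        intro a _
        rw [mem_annihilated]
        intro ξ hξ
        rw [(Submodule.mem_bot k).1 hξ, derivation_zero]
      rw [this]
      exact .top
    | pred w _ ih =>
      rw [← lieGE_eq_lieGT_sub_one]
      by_cases hw : l.IsWeight w
      · exact isSliceTower_lieGE hA (hl w hw) (hσ.2 w hw) ih
      · have : l.lieGE w = l.lieGT w := by
          refine le_antisymm ((l.lieGE_le_sup w).trans ?_) (l.lieGT_le_lieGE w)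
          rw [not_not.1 hw, bot_sup_eq]
        rw [this]
        exact ih
  have h0 := (key 0 (le_max_right _ _)).mono (Set.image_subset_range _ _)
  convert h0 using 1
  ext a
  rw [σ.mem_invariants_iff hU, hzero, mem_annihilated]
  simp

theorem vectorField_counit_comp_pow (ξ : LieAlg k H) (n : ℕ) (a : A) :
    σ.vectorField (Coalgebra.counit ∘ₗ (invariantDerivation ξ : H →ₗ[k] H) ^ n) a =
      (σ.derivation ξ)^[n] a := by
  induction n with
  | zero => exact σ.vectorField_counit a
  | succ n ih =>
    have e : Coalgebra.counit ∘ₗ (invariantDerivation ξ : H →ₗ[k] H) ^ (n + 1) =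
        conv (Coalgebra.counit ∘ₗ (invariantDerivation ξ : H →ₗ[k] H) ^ n)
          (LieAlg.toDual k H ξ) := by
      rw [pow_succ]
      rfl
    rw [e, vectorField_conv, ih, Function.iterate_succ_apply']
    rfl

/-- The one-parameter subgroup `exp(X ξ)` acts on functions by the exponential series of the
derivation defined by `ξ`. -/
theorem coeff_pairing_expPoint [CharZero k] (hU : IsUnipotent k H) (ξ : LieAlg k H) {R : Type u}
    [CommRing R] [Algebra k R] (y : A →ₐ[k] R) (a : A) (n : ℕ) :
    (pairing (expPoint hU ξ R) ((Polynomial.CAlgHom : R →ₐ[k] Polynomial R).comp y)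
      (σ.coactU a)).coeff n = y (SliceTower.dividedPower (σ.derivation ξ) n a) := by
  have h (z : H ⊗[k] A) : (pairing (expPoint hU ξ R)
      ((Polynomial.CAlgHom : R →ₐ[k] Polynomial R).comp y) z).coeff n =
        y ((n.factorial : k)⁻¹ • evalLeft A
          (Coalgebra.counit ∘ₗ (invariantDerivation ξ : H →ₗ[k] H) ^ n) z) := by
    induction z using TensorProduct.induction_on with
    | zero => simp
    | add z z' hz hz' => simp only [map_add, Polynomial.coeff_add, hz, hz', smul_add]
    | tmul b c =>
      rw [Algebra.TensorProduct.lift_tmul, AlgHom.comp_apply, Polynomial.CAlgHom_apply,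
        Polynomial.coeff_mul_C, expPoint, SliceTower.coeff_expPoly, evalLeft_tmul, smul_smul,
        map_smul, Algebra.smul_def]
      congr 1
      rw [SliceTower.dividedPower, LinearMap.smul_apply, map_smul, Algebra.smul_def, map_mul]
      rfl
  rw [h, ← vectorField_apply, vectorField_counit_comp_pow, SliceTower.dividedPower_apply]

/-- Points of the affine scheme that agree on the invariants are conjugate under the unipotent
group. -/
theorem IsAffineCDRS.exists_act_eq [CharZero k] (hU : IsUnipotent k H) (hl : l.IsGrading)
    (hσ : σ.IsAffineCDRS) {R : Type u} [CommRing R] [Algebra k R] (y y' : A →ₐ[k] R)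
    (hy : ∀ a ∈ σ.invariants, y a = y' a) :
    ∃ u : Points k H R, σ.act R (SemidirectProduct.inl u) y = y' := by
  let r : Setoid (A →ₐ[k] R) :=
    { r := fun y y' => ∃ u : Points k H R, σ.act R (SemidirectProduct.inl u) y = y'
      iseqv :=
        { refl := fun y => ⟨1, by rw [map_one, map_one, Equiv.Perm.one_apply]⟩
          symm := by
            rintro y _ ⟨u, rfl⟩
            refine ⟨u⁻¹, ?_⟩
            rw [← Equiv.Perm.mul_apply, ← map_mul, ← map_mul, inv_mul_cancel, map_one, map_one,
              Equiv.Perm.one_apply]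
          trans := by
            rintro y _ _ ⟨u, rfl⟩ ⟨v, rfl⟩
            exact ⟨v * u, by rw [map_mul, map_mul, Equiv.Perm.mul_apply]⟩ } }
  refine (hσ.isSliceTower hU hl).rel_of_forall_eq r ?_ y y' hy
  rintro _ ⟨ξ, rfl⟩ c y
  -- the point is moved by `exp(c ξ)`
  let u : Points k H R :=
    WithConv.toConv (((Polynomial.aeval c).restrictScalars k).comp (expPoint hU ξ R))
  have hact (a : A) : σ.act R (SemidirectProduct.inl u) y a =
      (pairing (expPoint hU ξ R) ((Polynomial.CAlgHom : R →ₐ[k] Polynomial R).comp y)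
        (σ.coactU a)).eval c := by
    rw [act_inl_apply]
    induction σ.coactU a using TensorProduct.induction_on with
    | zero => simp
    | add z z' hz hz' => simp only [map_add, Polynomial.eval_add, hz, hz']
    | tmul b d => simp [u, Polynomial.coe_aeval_eq_eval]
  refine ⟨σ.act R (SemidirectProduct.inl u) y, ⟨u, rfl⟩, fun a ha => ?_, fun a ha => ?_⟩
  · rw [hact]
    have : pairing (expPoint hU ξ R) ((Polynomial.CAlgHom : R →ₐ[k] Polynomial R).comp y)
        (σ.coactU a) = Polynomial.C (y a) := by
      ext n
      rw [coeff_pairing_expPoint, SliceTower.dividedPower_apply, Polynomial.coeff_C]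
      rcases n with _ | n
      · simp
      · rw [SliceTower.iterate_eq_zero_of_le (n := 1) _ ha (by omega)]
        simp
    rw [this, Polynomial.eval_C]
  · rw [hact]
    have h2 : (σ.derivation ξ)^[2] a = 0 := by
      change σ.derivation ξ (σ.derivation ξ a) = 0
      rw [ha, Derivation.map_one_eq_zero]
    have : pairing (expPoint hU ξ R) ((Polynomial.CAlgHom : R →ₐ[k] Polynomial R).comp y)
        (σ.coactU a) = Polynomial.C (y a) + Polynomial.X := by
      ext n
      rw [coeff_pairing_expPoint, SliceTower.dividedPower_apply, Polynomial.coeff_add,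
        Polynomial.coeff_C, Polynomial.coeff_X]
      rcases n with _ | _ | n
      · simp
      · simp [ha]
      · rw [SliceTower.iterate_eq_zero_of_le _ h2 (by omega)]
        simp
    rw [this, Polynomial.eval_add, Polynomial.eval_C, Polynomial.eval_X]

end Action
end OnePS
end UHat

/-! ### Geometric quotients with a section -/

namespace GeomQuot

variable {P X Z : Scheme.{u}} {s t : P ⟶ X} {π : X ⟶ Z}

theorem appLE_apply_congr {f g : X ⟶ Z} (h : f = g) {U : Z.Opens} {V : X.Opens}
    (e : V ≤ f ⁻¹ᵁ U) (e' : V ≤ g ⁻¹ᵁ U) (a : Γ(Z, U)) :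
    f.appLE U V e a = g.appLE U V e' a := by
  subst h
  rfl

theorem appLE_apply_of_eq_id {f : X ⟶ X} (h : f = 𝟙 X) {U : X.Opens} (e : U ≤ f ⁻¹ᵁ U)
    (a : Γ(X, U)) : f.appLE U U e a = a := by
  subst h
  have h : (𝟙 X : X ⟶ X).appLE U U e = (𝟙 X : X ⟶ X).app U := Scheme.Hom.appLE_eq_app _
  rw [h, Scheme.Hom.id_app]
  rfl

theorem appLE_appLE_apply (f : P ⟶ X) (g : X ⟶ Z) {U : Z.Opens} {V : X.Opens} {W : P.Opens}
    (e₁ : V ≤ g ⁻¹ᵁ U) (e₂ : W ≤ f ⁻¹ᵁ V) (e : W ≤ (f ≫ g) ⁻¹ᵁ U) (a : Γ(Z, U)) :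
    f.appLE V W e₂ (g.appLE U V e₁ a) = (f ≫ g).appLE U W e a := by
  rw [← CommRingCat.comp_apply, Scheme.Hom.appLE_comp_appLE]

/-- An affine invariant morphism `π` is a geometric quotient if it has a section `ε` and if there is
a morphism `c` which sends a pair `(x, y)` in `X ×_Z X` to some `(g, x)` with `g x = y`. Indeed each
point `x` is then conjugate to `ε (π x)`, so that an invariant function `f` is the pull-back of
`ε^* f` and the image of an invariant set is its preimage under `ε`. -/
theorem isGeometricQuotient_of_section [IsAffineHom π] (h : s ≫ π = t ≫ π) (ε : Z ⟶ X)
    (hε : ε ≫ π = 𝟙 Z) (c : pullback π π ⟶ P) (hs : c ≫ s = pullback.fst π π)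
    (ht : c ≫ t = pullback.snd π π) : IsGeometricQuotient s t π := by
  -- `p` sends `x` to some `(g, x)` with `g x = ε (π x)`
  let p : X ⟶ P := pullback.lift (𝟙 X) (π ≫ ε) (by rw [Category.assoc, hε]; simp) ≫ c
  have hps : p ≫ s = 𝟙 X := by simp [p, hs, pullback.lift_fst]
  have hpt : p ≫ t = π ≫ ε := by simp [p, ht, pullback.lift_snd]
  have hps' (x : X) : s (p x) = x := by
    rw [← Scheme.Hom.comp_apply, hps]
    rfl
  have hpt' (x : X) : t (p x) = ε (π x) := by
    rw [← Scheme.Hom.comp_apply, hpt]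
    rfl
  have hε' (z : Z) : π (ε z) = z := by
    rw [← Scheme.Hom.comp_apply, hε]
    rfl
  have happ {V : Z.Opens} : π.app V = π.appLE V (π ⁻¹ᵁ V) le_rfl := Scheme.Hom.app_eq_appLE _
  have hεV (V : Z.Opens) : V ≤ ε ⁻¹ᵁ (π ⁻¹ᵁ V) := fun z hz => by
    change π (ε z) ∈ V
    rw [hε']
    exact hz
  have himage {W : Set X} (hW : s ⁻¹' W = t ⁻¹' W) {x : X} (hx : x ∈ W) : ε (π x) ∈ W := by
    rw [← hpt', ← Set.mem_preimage, ← hW, Set.mem_preimage, hps']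
    exact hx
  refine ⟨h, inferInstance, ⟨fun z => ⟨ε z, hε' z⟩⟩, ⟨fun w => ⟨c w, ?_⟩⟩, fun V => ?_,
    fun V f => ⟨?_, fun hf => ?_⟩, fun W hW hinv => ?_, fun W₁ W₂ _ _ h₁ h₂ hd => ?_⟩
  · have : c ≫ pullback.lift s t h = 𝟙 _ := by
      apply pullback.hom_ext <;> simp [hs, ht, pullback.lift_fst, pullback.lift_snd]
    rw [← Scheme.Hom.comp_apply, this]
    rfl
  · intro a b hab
    rw [happ] at hab
    have h3 (a : Γ(Z, V)) : ε.appLE (π ⁻¹ᵁ V) V (hεV V) (π.appLE V (π ⁻¹ᵁ V) le_rfl a) = a :=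
      (appLE_appLE_apply ε π _ _ (hεV V) a).trans (appLE_apply_of_eq_id hε _ a)
    rw [← h3 a, hab, h3]
  · rintro ⟨f, rfl⟩
    rw [happ]
    refine (appLE_appLE_apply s π _ _ le_rfl f).trans (Eq.trans ?_
      (appLE_appLE_apply t π _ _ (by rw [h]) f).symm)
    exact appLE_apply_congr h _ _ f
  · have hp : π ⁻¹ᵁ V ≤ p ⁻¹ᵁ ((s ≫ π) ⁻¹ᵁ V) := by
      rw [← Scheme.Hom.comp_preimage, ← Category.assoc, hps, Category.id_comp]
    have hst : (s ≫ π) ⁻¹ᵁ V ≤ t ⁻¹ᵁ (π ⁻¹ᵁ V) := by rw [h]; exact le_rfl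
    have hps₁ : π ⁻¹ᵁ V ≤ (p ≫ s) ⁻¹ᵁ (π ⁻¹ᵁ V) := by rw [hps]; exact le_rfl
    have hpt₁ : π ⁻¹ᵁ V ≤ (π ≫ ε) ⁻¹ᵁ (π ⁻¹ᵁ V) := fun x hx => hεV V hx
    have hpt₂ : π ⁻¹ᵁ V ≤ (p ≫ t) ⁻¹ᵁ (π ⁻¹ᵁ V) := by rw [hpt]; exact hpt₁
    refine ⟨ε.appLE (π ⁻¹ᵁ V) V (hεV V) f, ?_⟩
    rw [happ]
    calc π.appLE V (π ⁻¹ᵁ V) le_rfl (ε.appLE (π ⁻¹ᵁ V) V (hεV V) f)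
        = (π ≫ ε).appLE (π ⁻¹ᵁ V) (π ⁻¹ᵁ V) hpt₁ f := appLE_appLE_apply π ε _ _ _ f
      _ = (p ≫ t).appLE (π ⁻¹ᵁ V) (π ⁻¹ᵁ V) hpt₂ f :=
        appLE_apply_congr hpt.symm _ _ f
      _ = p.appLE _ _ hp (t.appLE (π ⁻¹ᵁ V) ((s ≫ π) ⁻¹ᵁ V) hst f) :=
        (appLE_appLE_apply p t _ _ _ f).symm
      _ = p.appLE _ _ hp (s.appLE (π ⁻¹ᵁ V) ((s ≫ π) ⁻¹ᵁ V) le_rfl f) := by rw [hf]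
      _ = (p ≫ s).appLE (π ⁻¹ᵁ V) (π ⁻¹ᵁ V) hps₁ f := appLE_appLE_apply p s _ _ _ f
      _ = f := appLE_apply_of_eq_id hps _ f
  · have : π '' W = ε ⁻¹' W := by
      ext z
      constructor
      · rintro ⟨x, hx, rfl⟩
        exact himage hinv hx
      · exact fun hz => ⟨ε z, hz, hε' z⟩
    rw [this]
    exact hW.preimage ε.continuous
  · rw [Set.disjoint_left]
    rintro _ ⟨x, hx, rfl⟩ ⟨y, hy, hxy⟩
    have h3 := himage h₂ hy
    rw [hxy] at h3
    exact Set.disjoint_left.1 hd (himage h₁ hx) h3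

/-- The data of `isGeometricQuotient_of_section` are stable under base change. -/
theorem isUniversalGeometricQuotient_of_section [IsAffineHom π] (h : s ≫ π = t ≫ π) (ε : Z ⟶ X)
    (hε : ε ≫ π = 𝟙 Z) (c : pullback π π ⟶ P) (hs : c ≫ s = pullback.fst π π)
    (ht : c ≫ t = pullback.snd π π) : IsUniversalGeometricQuotient s t π := by
  refine ⟨h, fun Z' g => ?_⟩
  have hstable : MorphismProperty.IsStableUnderBaseChange @IsAffineHom.{u} := inferInstance
  have : IsAffineHom (pullback.snd π g) :=
    MorphismProperty.of_isPullback (P := @IsAffineHom) (IsPullback.of_hasPullback π g) ‹_›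
  have hinv : baseChange (s ≫ π) π g s rfl ≫ pullback.snd π g =
      baseChange (s ≫ π) π g t h ≫ pullback.snd π g := by
    simp [baseChange, pullback.map, pullback.lift_snd]
  refine isGeometricQuotient_of_section hinv
    (pullback.lift (g ≫ ε) (𝟙 Z') (by rw [Category.assoc, hε]; simp)) (pullback.lift_snd _ _ _)
    (pullback.lift (pullback.lift (pullback.fst _ _ ≫ pullback.fst π g)
      (pullback.snd _ _ ≫ pullback.fst π g) ?_ ≫ c) (pullback.fst _ _ ≫ pullback.snd π g) ?_) ?_ ?_
  · rw [Category.assoc, Category.assoc, pullback.condition, pullback.condition_assoc]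
  · rw [Category.assoc, ← Category.assoc c, hs, pullback.lift_fst_assoc, Category.assoc,
      Category.assoc, pullback.condition]
  · apply pullback.hom_ext
    · simp [baseChange, hs, pullback.map, pullback.lift_fst, pullback.lift_fst_assoc]
    · simp [baseChange, pullback.map, pullback.lift_snd]
  · apply pullback.hom_ext
    · simp [baseChange, ht, pullback.map, pullback.lift_fst, pullback.lift_fst_assoc,
        pullback.lift_snd]
    · simp [baseChange, pullback.condition, pullback.map, pullback.lift_snd]

end GeomQuot

/-! ### The quotient of `Y` by `U` -/

namespace UHat

namespace OnePS

namespace Action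

variable {k H : Type u} [Field k] [CommRing H] [HopfAlgebra k H] {l : OnePS k H}
  {A : Type u} [CommRing A] [Algebra k A] {σ : l.Action A}

theorem IsAffineCDRS.exists_algEquiv [CharZero k] (hU : IsUnipotent k H) (hl : l.IsGrading)
    (hσ : σ.IsAffineCDRS) :
    ∃ m : ℕ, Nonempty (MvPolynomial (ULift.{u} (Fin m)) σ.invariants ≃ₐ[σ.invariants] A) := by
  obtain ⟨ι, _, x, hx⟩ := (hσ.isSliceTower hU hl).exists_bijective_aeval
  let e : Fin (Nat.card ι) ≃ ι := (Finite.equivFin ι).symm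
  exact ⟨Nat.card ι, ⟨(MvPolynomial.renameEquiv _ (Equiv.ulift.trans e)).trans
    (AlgEquiv.ofBijective _ hx)⟩⟩

variable (σ) in
theorem projMor_comp_quotientMor :
    σ.projMor ≫ σ.quotientMor = σ.actMor ≫ σ.quotientMor := by
  refine (Spec.map_comp _ _).symm.trans ((congrArg Spec.map ?_).trans (Spec.map_comp _ _))
  ext a
  exact a.2.symm

/-- Two points of `Y` with the same image in `Y / U` are conjugate under `U`. For the universal such
pair, the two projections of `Y ×_{Y/U} Y`, this gives a morphism to `U × Y`. -/
theorem IsAffineCDRS.exists_pullback_hom [CharZero k] (hU : IsUnipotent k H) (hl : l.IsGrading)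
    (hσ : σ.IsAffineCDRS) : ∃ c : pullback σ.quotientMor σ.quotientMor ⟶ σ.groupTimes,
      c ≫ σ.projMor = pullback.fst _ _ ∧ c ≫ σ.actMor = pullback.snd _ _ := by
  let y : A →ₐ[k] A ⊗[σ.invariants] A :=
    (Algebra.TensorProduct.includeLeft : A →ₐ[σ.invariants] _).restrictScalars k
  let y' : A →ₐ[k] A ⊗[σ.invariants] A :=
    (Algebra.TensorProduct.includeRight : A →ₐ[σ.invariants] _).restrictScalars k
  obtain ⟨u, hu⟩ := hσ.exists_act_eq hU hl y y' fun a ha =>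
    ((Algebra.TensorProduct.includeLeft : A →ₐ[σ.invariants] A ⊗[σ.invariants] A).commutes
      ⟨a, ha⟩).trans ((Algebra.TensorProduct.includeRight :
        A →ₐ[σ.invariants] A ⊗[σ.invariants] A).commutes ⟨a, ha⟩).symm
  refine ⟨(pullbackSpecIso σ.invariants A A).hom ≫
    Spec.map (CommRingCat.ofHom (pairing u.ofConv y).toRingHom), ?_, ?_⟩
  · refine (Category.assoc _ _ _).trans ((congrArg ((pullbackSpecIso σ.invariants A A).hom ≫ ·)
      ?_).trans (pullbackSpecIso_hom_fst σ.invariants A A))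
    refine (Spec.map_comp _ _).symm.trans (congrArg Spec.map ?_)
    ext a
    simp [y]
  · refine (Category.assoc _ _ _).trans ((congrArg ((pullbackSpecIso σ.invariants A A).hom ≫ ·)
      ?_).trans (pullbackSpecIso_hom_snd σ.invariants A A))
    refine (Spec.map_comp _ _).symm.trans (congrArg Spec.map ?_)
    ext a
    exact (σ.act_inl_apply u y a).symm.trans (DFunLike.congr_fun hu a)

end Action
end OnePS
end UHat

theorem mainTheorem7 (k : Type u) [Field k] [IsAlgClosed k] [CharZero k]
    (H : Type u) [CommRing H] [HopfAlgebra k H] (hU : UHat.IsUnipotent k H)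
    (l : UHat.OnePS k H) (hl : l.IsGrading)
    (A : Type u) [CommRing A] [Algebra k A] [Algebra.FiniteType k A]
    (σ : l.Action A) (hσ : σ.IsAffineCDRS) :
    Algebra.FiniteType k σ.invariants ∧
    GeomQuot.IsUniversalGeometricQuotient σ.projMor σ.actMor σ.quotientMor ∧
    ∃ (m : ℕ) (e : Spec (.of A) ≅ 𝔸(ULift.{u} (Fin m); σ.quotientScheme)),
      e.hom ≫ (𝔸(ULift.{u} (Fin m); σ.quotientScheme) ↘ σ.quotientScheme) = σ.quotientMor := by
  obtain ⟨m, ⟨e⟩⟩ := hσ.exists_algEquiv hU hl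
  -- the retraction of `A` onto `A^U` which sends the polynomial generators to `0`
  let r : A →ₐ[σ.invariants] σ.invariants := (MvPolynomial.aeval fun _ => 0).comp e.symm.toAlgHom
  refine ⟨.of_surjective (r.restrictScalars k) fun b => ⟨b, r.commutes b⟩, ?_, m, ?_⟩
  · obtain ⟨c, hs, ht⟩ := hσ.exists_pullback_hom hU hl
    have : IsAffineHom σ.quotientMor :=
      inferInstanceAs (IsAffineHom (Spec.map (CommRingCat.ofHom (algebraMap σ.invariants A))))
    refine GeomQuot.isUniversalGeometricQuotient_of_section σ.projMor_comp_quotientMor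
      (Spec.map (CommRingCat.ofHom r.toRingHom)) ?_ c hs ht
    refine (Spec.map_comp _ _).symm.trans (Eq.trans (congrArg Spec.map ?_) (Spec.map_id _))
    ext b
    exact congrArg _ (r.commutes b)
  · refine ⟨Scheme.Spec.mapIso e.toRingEquiv.toCommRingCatIso.op ≪≫
      (AffineSpace.SpecIso _ (.of σ.invariants)).symm, ?_⟩
    refine (Category.assoc _ _ _).trans ((congrArg (Spec.map (CommRingCat.ofHom
      e.toRingEquiv.toRingHom) ≫ ·) (AffineSpace.SpecIso_inv_over (.of σ.invariants))).trans ?_)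
    refine (Spec.map_comp _ _).symm.trans (congrArg Spec.map ?_)
    ext b
    exact e.commutes b
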